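/- Let $X=(X_t)_{t\ge 0}$ be a stationary first-order Markov process on a measurable space $\mathcal X$ with transition kernel $Q$ and stationary distribution $Q_0$, and let $Q_0\otimes Q$ be the law of $(X_t,X_{t+1})$. Write $\mathbb E^Q$ for conditional expectation under $Q$. Let $\beta\in(0,1)$, $\theta>0$ and $\alpha=-\frac{1}{\theta(1-\beta)}$. For $s\ge 1$ let $\phi_s(x)=e^{x^s}-1$, let $\|f\|_{\phi_s}=\inf\{c>0:\mathbb E^{Q_0}[\phi_s(|f(X_t)|/c)]\le 1\}$, and let the Orlicz heart $E^{\phi_s}$ be the space of ($Q_0$-equivalence classes of) measurable $f:\mathcal X\to\mathbb R$ with $\|f\|_{\phi_s}<\infty$ and $\mathbb E^{Q_0}[\phi_s(|f(X_t)|/c)]<\infty$ for every $c>0$, normed by $\|\cdot\|_{\phi_s}$. Let $E_2^{\phi_s}$ be the analogous space of functions of $(X_t,X_{t+1})$ under $Q_0\otimes Q$. Suppose that $u\in E_2^{\phi_r}$ for some $r>1$. Put $$\mathbb T f(x)=\beta\log\mathbb E^Q\big[e^{f(X_{t+1})+\alpha u(X_t,X_{t+1})}\,\big|\,X_t=x\big].$$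 Then $\mathbb T$ has a fixed point $v\in E^{\phi_r}$, and $v$ is the unique fixed point of $\mathbb T$ in $E^{\phi_s}$ for each $1<s\le r$. For this $v$ let $$m_v(X_t,X_{t+1})=\frac{e^{v(X_{t+1})+\alpha u(X_t,X_{t+1})}}{\mathbb E^Q[e^{v(X_{t+1})+\alpha u(X_t,X_{t+1})}\,|\,X_t]},\qquad \mathbb D_v f(x)=\beta\,\mathbb E^Q[m_v(X_t,X_{t+1})f(X_{t+1})\,|\,X_t=x],$$ $$\chi_v(x)=\beta\,\mathbb E^Q[m_v(X_t,X_{t+1})\log m_v(X_t,X_{t+1})\,|\,X_t=x].$$ Then there is a function $\Gamma$ on $\mathcal X$ such that for each $1\le s\le r$: $\mathbb D_v$ is a well-defined bounded linear operator on $E^{\phi_s}$, $\chi_v\in E^{\phi_s}$, $\mathbb I-\mathbb D_v$ has a bounded inverse on $E^{\phi_s}$, and $\Gamma=(\mathbb I-\mathbb D_v)^{-1}\chi_v$ is the unique solution in $E^{\phi_s}$ of $$(\mathbb I-\mathbb D_v)\Gamma=\chi_v.$$ -/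

import Mathlib

open MeasureTheory ProbabilityTheory
open scoped ENNReal

noncomputable section

namespace ThinTail

/-! ### Exponential Orlicz hearts -/

section Orlicz

/-- The Young function `φ_s(x) = exp(x^s) - 1` (used for `s ≥ 1` and `x ≥ 0`). -/
def phi (s x : ℝ) : ℝ := Real.exp (x ^ s) - 1

theorem phi_nonneg {s x : ℝ} (hx : 0 ≤ x) : 0 ≤ phi s x := by
  have h : 0 ≤ x ^ s := Real.rpow_nonneg hx s
  have := Real.one_le_exp h
  simp only [phi]; linarith

theorem phi_zero {s : ℝ} (hs : 1 ≤ s) : phi s 0 = 0 := by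
  have : s ≠ 0 := by linarith
  simp [phi, Real.zero_rpow this]

theorem phi_mono {s x y : ℝ} (hs : 1 ≤ s) (hx : 0 ≤ x) (hxy : x ≤ y) : phi s x ≤ phi s y := by
  have : x ^ s ≤ y ^ s := Real.rpow_le_rpow hx hxy (by linarith)
  have := Real.exp_le_exp.2 this
  simp only [phi]; linarith

theorem phi_pos {s x : ℝ} (hx : 0 < x) : 0 < phi s x := by
  have : 0 < x ^ s := Real.rpow_pos_of_pos hx s
  have := Real.one_lt_exp_iff.2 this
  simp only [phi]; linarith

theorem phi_convex {s a b x y : ℝ} (hs : 1 ≤ s) (ha : 0 ≤ a) (hb : 0 ≤ b) (hab : a + b = 1)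
    (hx : 0 ≤ x) (hy : 0 ≤ y) : phi s (a * x + b * y) ≤ a * phi s x + b * phi s y := by
  have h1 := (convexOn_rpow hs).2 (Set.mem_Ici.2 hx) (Set.mem_Ici.2 hy) ha hb hab
  have h2 := convexOn_exp.2 (Set.mem_univ (x ^ s)) (Set.mem_univ (y ^ s)) ha hb hab
  simp only [smul_eq_mul] at h1 h2
  have h3 := (Real.exp_le_exp.2 h1).trans h2
  simp only [phi]
  nlinarith

theorem phi_mul_le {s a x : ℝ} (hs : 1 ≤ s) (ha : 0 ≤ a) (ha1 : a ≤ 1) (hx : 0 ≤ x) :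
    phi s (a * x) ≤ a * phi s x := by
  have := phi_convex (s := s) (a := a) (b := 1 - a) (x := x) (y := 0) hs ha (by linarith)
    (by ring) hx le_rfl
  simpa [phi_zero hs] using this

theorem measurable_phi (s : ℝ) : Measurable (phi s) := by
  unfold phi
  fun_prop

variable {S : Type*} [MeasurableSpace S]

/-- The modular `E^μ[φ_s(|f|/c)]`, as an extended nonnegative number. -/
def modular (μ : Measure S) (s : ℝ) (f : S → ℝ) (c : ℝ) : ℝ≥0∞ :=
  ∫⁻ x, ENNReal.ofReal (phi s (|f x| / c)) ∂μ

/-- The Luxemburg norm `inf {c > 0 : E^μ[φ_s(|f|/c)] ≤ 1}`; it is `∞` if there is no such `c`. -/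
def luxNorm (μ : Measure S) (s : ℝ) (f : S → ℝ) : ℝ≥0∞ :=
  ⨅ (c : ℝ) (_ : 0 < c) (_ : modular μ s f c ≤ 1), ENNReal.ofReal c

/-- Membership in the Orlicz space `L^{φ_s}(μ)`. -/
def MemOrlicz (μ : Measure S) (s : ℝ) (f : S → ℝ) : Prop :=
  AEStronglyMeasurable f μ ∧ luxNorm μ s f < ∞

/-- Membership in the Orlicz heart `E^{φ_s}(μ)`. -/
def MemHeart (μ : Measure S) (s : ℝ) (f : S → ℝ) : Prop :=
  MemOrlicz μ s f ∧ ∀ c : ℝ, 0 < c → modular μ s f c < ∞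

variable {μ : Measure S} {s : ℝ} {f g : S → ℝ}

theorem modular_congr (h : f =ᵐ[μ] g) (c : ℝ) : modular μ s f c = modular μ s g c := by
  refine lintegral_congr_ae ?_
  filter_upwards [h] with x hx
  rw [hx]

theorem luxNorm_congr (h : f =ᵐ[μ] g) : luxNorm μ s f = luxNorm μ s g := by
  simp only [luxNorm, modular_congr h]

theorem MemHeart.congr (h : f =ᵐ[μ] g) (hf : MemHeart μ s f) : MemHeart μ s g :=
  ⟨⟨hf.1.1.congr h, luxNorm_congr (s := s) h ▸ hf.1.2⟩,
    fun c hc => modular_congr (s := s) h c ▸ hf.2 c hc⟩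

theorem luxNorm_le {c : ℝ} (hc : 0 < c) (h : modular μ s f c ≤ 1) :
    luxNorm μ s f ≤ ENNReal.ofReal c :=
  iInf_le_of_le c (iInf_le_of_le hc (iInf_le _ h))

theorem exists_of_luxNorm_lt {a : ℝ≥0∞} (h : luxNorm μ s f < a) :
    ∃ c : ℝ, 0 < c ∧ modular μ s f c ≤ 1 ∧ ENNReal.ofReal c < a := by
  simp only [luxNorm, iInf_lt_iff] at h
  obtain ⟨c, hc, h1, h2⟩ := h
  exact ⟨c, hc, h1, h2⟩

theorem modular_zero (hs : 1 ≤ s) (c : ℝ) : modular μ s (fun _ => (0 : ℝ)) c = 0 := by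
  simp [modular, phi_zero hs]

theorem modular_smul {a : ℝ} (ha : a ≠ 0) (c : ℝ) :
    modular μ s (fun x => a * f x) c = modular μ s f (c / |a|) := by
  have : |a| ≠ 0 := abs_ne_zero.2 ha
  simp only [modular]
  refine lintegral_congr fun x => ?_
  congr 2
  rw [abs_mul]
  field_simp

theorem aemeasurable_modular (hf : AEStronglyMeasurable f μ) (c : ℝ) :
    AEMeasurable (fun x => ENNReal.ofReal (phi s (|f x| / c))) μ :=
  ((measurable_phi s).comp_aemeasurable
    ((continuous_abs.measurable.comp_aemeasurable hf.aemeasurable).div_const c)).ennreal_ofReal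

theorem modular_add_le (hs : 1 ≤ s) (hf : AEStronglyMeasurable f μ) {c d : ℝ} (hc : 0 < c)
    (hd : 0 < d) :
    modular μ s (fun x => f x + g x) (c + d) ≤
      ENNReal.ofReal (c / (c + d)) * modular μ s f c +
        ENNReal.ofReal (d / (c + d)) * modular μ s g d := by
  have hcd : 0 < c + d := by linarith
  simp only [modular]
  rw [← lintegral_const_mul' _ _ ENNReal.ofReal_ne_top,
    ← lintegral_const_mul' _ _ ENNReal.ofReal_ne_top,
    ← lintegral_add_left' ((aemeasurable_modular hf c).const_mul _)]
  refine lintegral_mono fun x => ?_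
  have p1 : 0 ≤ c / (c + d) := by positivity
  have p2 : 0 ≤ d / (c + d) := by positivity
  have q1 : 0 ≤ |f x| / c := by positivity
  have q2 : 0 ≤ |g x| / d := by positivity
  change ENNReal.ofReal _ ≤ ENNReal.ofReal _ * ENNReal.ofReal _ +
    ENNReal.ofReal _ * ENNReal.ofReal _
  rw [← ENNReal.ofReal_mul p1, ← ENNReal.ofReal_mul p2,
    ← ENNReal.ofReal_add (mul_nonneg p1 (phi_nonneg q1)) (mul_nonneg p2 (phi_nonneg q2))]
  refine ENNReal.ofReal_le_ofReal ?_
  refine le_trans (phi_mono hs (by positivity) ?_)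
    (phi_convex hs p1 p2 (by field_simp) q1 q2)
  have e : c / (c + d) * (|f x| / c) + d / (c + d) * (|g x| / d) = (|f x| + |g x|) / (c + d) := by
    field_simp
  rw [e]
  gcongr
  exact abs_add_le _ _

theorem luxNorm_zero (hs : 1 ≤ s) : luxNorm μ s (fun _ => (0 : ℝ)) = 0 := by
  refine le_antisymm ?_ bot_le
  refine ENNReal.le_of_forall_pos_le_add fun ε hε _ => ?_
  have h := luxNorm_le (μ := μ) (s := s) (f := fun _ => (0 : ℝ)) (c := ε) (by exact_mod_cast hε)
    (by rw [modular_zero hs]; exact zero_le_one)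
  simpa using h

theorem luxNorm_add_le (hs : 1 ≤ s) (hf : AEStronglyMeasurable f μ) :
    luxNorm μ s (fun x => f x + g x) ≤ luxNorm μ s f + luxNorm μ s g := by
  refine le_of_forall_gt fun a ha => ?_
  obtain ⟨b, hb, d, hd, hbd⟩ : ∃ b, luxNorm μ s f < b ∧ ∃ d, luxNorm μ s g < d ∧ b + d < a := by
    obtain ⟨ε, hε, h⟩ := ENNReal.lt_iff_exists_add_pos_lt.1 ha
    have hfin := ENNReal.add_lt_top.1 (lt_top_of_lt ha)
    have hε2 : (ε : ℝ≥0∞) / 2 ≠ 0 := by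
      have : (ε : ℝ≥0∞) ≠ 0 := by exact_mod_cast hε.ne'
      simpa using this
    refine ⟨_, ENNReal.lt_add_right hfin.1.ne hε2, _, ENNReal.lt_add_right hfin.2.ne hε2, ?_⟩
    rwa [add_add_add_comm, ENNReal.add_halves]
  obtain ⟨c, hc, h1, h2⟩ := exists_of_luxNorm_lt hb
  obtain ⟨e, he, h3, h4⟩ := exists_of_luxNorm_lt hd
  have hce : 0 < c + e := by linarith
  refine lt_of_le_of_lt (luxNorm_le (c := c + e) hce ?_) ?_
  · refine (modular_add_le hs hf hc he).trans ?_
    calc _ ≤ ENNReal.ofReal (c / (c + e)) * 1 + ENNReal.ofReal (e / (c + e)) * 1 := by gcongr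
      _ = 1 := by
        rw [mul_one, mul_one, ← ENNReal.ofReal_add (by positivity) (by positivity)]
        rw [← add_div, div_self hce.ne', ENNReal.ofReal_one]
  · rw [ENNReal.ofReal_add hc.le he.le]
    exact (add_le_add h2.le h4.le).trans_lt hbd

theorem luxNorm_smul_le {a : ℝ} (ha : a ≠ 0) :
    luxNorm μ s (fun x => a * f x) ≤ ENNReal.ofReal |a| * luxNorm μ s f := by
  have hp : 0 < |a| := abs_pos.2 ha
  simp only [luxNorm]
  rw [ENNReal.mul_iInf_of_ne (by simpa using ha) ENNReal.ofReal_ne_top]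
  refine le_iInf fun c => ?_
  rw [ENNReal.mul_iInf_of_ne (by simpa using ha) ENNReal.ofReal_ne_top]
  refine le_iInf fun hc => ?_
  rw [ENNReal.mul_iInf_of_ne (by simpa using ha) ENNReal.ofReal_ne_top]
  refine le_iInf fun h => ?_
  rw [← ENNReal.ofReal_mul hp.le]
  refine luxNorm_le (by positivity) ?_
  rw [modular_smul ha, mul_div_cancel_left₀ _ hp.ne']
  exact h

theorem luxNorm_smul (hs : 1 ≤ s) (a : ℝ) :
    luxNorm μ s (fun x => a * f x) = ENNReal.ofReal |a| * luxNorm μ s f := by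
  rcases eq_or_ne a 0 with rfl | ha
  · simp [luxNorm_zero hs]
  refine le_antisymm (luxNorm_smul_le ha) ?_
  have h := luxNorm_smul_le (μ := μ) (s := s) (f := fun x => a * f x) (inv_ne_zero ha)
  have e : (fun x => a⁻¹ * (a * f x)) = f := by
    funext x; field_simp
  rw [e] at h
  calc _ ≤ ENNReal.ofReal |a| * (ENNReal.ofReal |a⁻¹| * luxNorm μ s (fun x => a * f x)) := by
        gcongr
    _ = luxNorm μ s (fun x => a * f x) := by
        rw [← mul_assoc, ← ENNReal.ofReal_mul (abs_nonneg a), ← abs_mul, mul_inv_cancel₀ ha]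
        simp

theorem ae_eq_zero_of_luxNorm (hs : 1 ≤ s) (hf : AEStronglyMeasurable f μ)
    (h : luxNorm μ s f = 0) : f =ᵐ[μ] fun _ => 0 := by
  have key : modular μ s f 1 = 0 := by
    refine le_antisymm ?_ bot_le
    refine ENNReal.le_of_forall_pos_le_add fun ε hε _ => ?_
    have hε' : (0 : ℝ) < min ε 1 := by
      have : (0 : ℝ) < ε := by exact_mod_cast hε
      positivity
    obtain ⟨c, hc, h1, h2⟩ := exists_of_luxNorm_lt
      (show luxNorm μ s f < ENNReal.ofReal (min ε 1) by rw [h]; exact ENNReal.ofReal_pos.2 hε')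
    have hlt : c < min ε 1 := (ENNReal.ofReal_lt_ofReal_iff hε').1 h2
    have hc1 : c ≤ 1 := hlt.le.trans (min_le_right _ _)
    have hcε : c ≤ ε := hlt.le.trans (min_le_left _ _)
    calc modular μ s f 1 ≤ ENNReal.ofReal c * modular μ s f c := by
          simp only [modular]
          rw [← lintegral_const_mul' _ _ ENNReal.ofReal_ne_top]
          refine lintegral_mono fun x => ?_
          change ENNReal.ofReal _ ≤ ENNReal.ofReal _ * ENNReal.ofReal _
          rw [← ENNReal.ofReal_mul hc.le]
          refine ENNReal.ofReal_le_ofReal ?_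
          have := phi_mul_le (s := s) (a := c) (x := |f x| / c) hs hc.le hc1 (by positivity)
          rw [mul_div_cancel₀ _ hc.ne'] at this
          rwa [div_one]
      _ ≤ ENNReal.ofReal c * 1 := by gcongr
      _ ≤ 0 + ε := by
          rw [mul_one, zero_add]
          exact ENNReal.ofReal_le_of_le_toReal (by simpa using hcε)
  rw [modular, lintegral_eq_zero_iff' (aemeasurable_modular hf 1)] at key
  filter_upwards [key] with x hx
  by_contra hne
  have := phi_pos (s := s) (x := |f x| / 1) (by simpa using hne)
  exact absurd hx (by simpa using this)

theorem MemHeart.zero (hs : 1 ≤ s) : MemHeart μ s (fun _ => (0 : ℝ)) :=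
  ⟨⟨aestronglyMeasurable_const, by simp [luxNorm_zero hs]⟩,
    fun c _ => by simp [modular_zero hs]⟩

theorem MemHeart.add (hs : 1 ≤ s) (hf : MemHeart μ s f) (hg : MemHeart μ s g) :
    MemHeart μ s (fun x => f x + g x) := by
  refine ⟨⟨hf.1.1.add hg.1.1, (luxNorm_add_le hs hf.1.1).trans_lt
    (ENNReal.add_lt_top.2 ⟨hf.1.2, hg.1.2⟩)⟩, fun c hc => ?_⟩
  have h := modular_add_le (g := g) hs hf.1.1 (half_pos hc) (half_pos hc)
  rw [add_halves] at h
  exact h.trans_lt (ENNReal.add_lt_top.2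
    ⟨ENNReal.mul_lt_top ENNReal.ofReal_lt_top (hf.2 _ (half_pos hc)),
      ENNReal.mul_lt_top ENNReal.ofReal_lt_top (hg.2 _ (half_pos hc))⟩)

theorem MemHeart.smul (hs : 1 ≤ s) (a : ℝ) (hf : MemHeart μ s f) :
    MemHeart μ s (fun x => a * f x) := by
  refine ⟨⟨hf.1.1.const_mul a, ?_⟩, fun c hc => ?_⟩
  · rw [luxNorm_smul hs]
    exact ENNReal.mul_lt_top ENNReal.ofReal_lt_top hf.1.2
  · rcases eq_or_ne a 0 with rfl | ha
    · simp [modular_zero hs]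
    · rw [modular_smul ha]
      exact hf.2 _ (div_pos hc (abs_pos.2 ha))

variable (μ s)

/-- The Orlicz heart `E^{φ_s}(μ)` as a vector space of `μ`-equivalence classes of functions. -/
def OrliczHeart [hs : Fact (1 ≤ s)] : Submodule ℝ (S →ₘ[μ] ℝ) where
  carrier := {f | MemHeart μ s f}
  zero_mem' := (MemHeart.zero hs.out).congr AEEqFun.coeFn_zero.symm
  add_mem' {f g} hf hg := (MemHeart.add hs.out hf hg).congr (AEEqFun.coeFn_add f g).symm
  smul_mem' a f hf := (MemHeart.smul hs.out a hf).congr (AEEqFun.coeFn_smul a f).symm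

variable {μ s} [hs : Fact (1 ≤ s)]

instance : Norm (OrliczHeart μ s) := ⟨fun f => (luxNorm μ s (f : S →ₘ[μ] ℝ)).toReal⟩

theorem norm_def (f : OrliczHeart μ s) : ‖f‖ = (luxNorm μ s (f : S →ₘ[μ] ℝ)).toReal := rfl

theorem normedSpaceCore : NormedSpace.Core ℝ (OrliczHeart μ s) where
  norm_nonneg f := ENNReal.toReal_nonneg
  norm_smul a f := by
    rw [norm_def, norm_def, Submodule.coe_smul,
      luxNorm_congr (g := fun x => a * (f : S →ₘ[μ] ℝ) x) (AEEqFun.coeFn_smul a (f : S →ₘ[μ] ℝ)),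
      luxNorm_smul hs.out, ENNReal.toReal_mul, ENNReal.toReal_ofReal (abs_nonneg a),
      Real.norm_eq_abs]
  norm_triangle f g := by
    rw [norm_def, norm_def, norm_def, Submodule.coe_add,
      luxNorm_congr (g := fun x => (f : S →ₘ[μ] ℝ) x + (g : S →ₘ[μ] ℝ) x)
        (AEEqFun.coeFn_add (f : S →ₘ[μ] ℝ) (g : S →ₘ[μ] ℝ)),
      ← ENNReal.toReal_add f.2.1.2.ne g.2.1.2.ne]
    exact ENNReal.toReal_mono (ENNReal.add_ne_top.2 ⟨f.2.1.2.ne, g.2.1.2.ne⟩)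
      (luxNorm_add_le hs.out f.2.1.1)
  norm_eq_zero_iff f := by
    rw [norm_def]
    constructor
    · intro h
      have h0 : luxNorm μ s (f : S →ₘ[μ] ℝ) = 0 :=
        ((ENNReal.toReal_eq_zero_iff _).1 h).resolve_right f.2.1.2.ne
      have h1 := ae_eq_zero_of_luxNorm hs.out f.2.1.1 h0
      exact Subtype.ext (AEEqFun.ext (h1.trans AEEqFun.coeFn_zero.symm))
    · rintro rfl
      rw [luxNorm_congr (g := fun _ => (0 : ℝ)) (by exact AEEqFun.coeFn_zero),
        luxNorm_zero hs.out, ENNReal.toReal_zero]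

/-- `E^{φ_s}(μ)` carries the Luxemburg norm. -/
instance : NormedAddCommGroup (OrliczHeart μ s) := NormedAddCommGroup.ofCore normedSpaceCore

instance : NormedSpace ℝ (OrliczHeart μ s) := NormedSpace.ofCore normedSpaceCore

end Orlicz

/-! ### The value recursion, the worst-case distortion and continuation entropy -/

section Model

variable {X : Type*} [MeasurableSpace X]

/-- `α = -1 / (θ (1 - β))`. -/
def alpha (β θ : ℝ) : ℝ := -1 / (θ * (1 - β))

/-- The unnormalized distortion `exp(f(y) + α u(x, y))`. -/
def expWeight (β θ : ℝ) (u : X × X → ℝ) (f : X → ℝ) (x y : X) : ℝ :=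
  Real.exp (f y + alpha β θ * u (x, y))

/-- `T f(x) = β log E^Q[exp(f(X_{t+1}) + α u(X_t, X_{t+1})) | X_t = x]`. -/
def valueOp (Q : Kernel X X) (β θ : ℝ) (u : X × X → ℝ) (f : X → ℝ) (x : X) : ℝ :=
  β * Real.log (∫ y, expWeight β θ u f x y ∂(Q x))

/-- The belief distortion `m_v(x, y)`: the weight `exp(v(y) + α u(x, y))` divided by its
conditional expectation given `X_t = x`. -/
def distortion (Q : Kernel X X) (β θ : ℝ) (u : X × X → ℝ) (v : X → ℝ) (x y : X) : ℝ :=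
  expWeight β θ u v x y / ∫ z, expWeight β θ u v x z ∂(Q x)

/-- `D_v f(x) = β E^Q[m_v(X_t, X_{t+1}) f(X_{t+1}) | X_t = x]`. -/
def discountedOp (Q : Kernel X X) (β θ : ℝ) (u : X × X → ℝ) (v f : X → ℝ) (x : X) : ℝ :=
  β * ∫ y, distortion Q β θ u v x y * f y ∂(Q x)

/-- `χ_v(x) = β E_v[log m_v(X_t, X_{t+1}) | X_t = x]`, the discounted conditional entropy of
`m_v`; the expectation `E_v` carries the weight `m_v`. -/
def condEntropy (Q : Kernel X X) (β θ : ℝ) (u : X × X → ℝ) (v : X → ℝ) (x : X) : ℝ :=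
  β * ∫ y, distortion Q β θ u v x y * Real.log (distortion Q β θ u v x y) ∂(Q x)

end Model

end ThinTail

end

/-! The value recursion and its linearization are controlled through the modulars `E[φ_s(|f|/c)]`,
scale by scale. The basic fact is that `y ↦ φ_s(log y / c)` is convex for large `y`: for every `c >
0` if `s > 1`, and for `c = 1` if `s = 1`. A conditional Jensen inequality then bounds the modular
of `log E[e^g | X_t]` by that of `g` plus a constant (`exists_phi_log_lintegral_exp_le`), and
stationarity returns functions of `X_{t+1}` to the law `Q₀`.

Existence. With `F = e^f` the recursion becomes an order-preserving map of `[0,∞]`-valued functions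
that commutes with increasing suprema. For `|a|`, where `a = αu`, the iterates from `1` increase;
discounting by `β` keeps their log-modulars below a bound depending only on the scale, so their
supremum `F` is an a.e. finite fixed point with `log F` in the heart. By Jensen for `1/z`, `F⁻¹` is
a subsolution for `a`, while `F` is a supersolution. Iterating from `F⁻¹` gives a fixed point `G`
with `F⁻¹ ≤ G ≤ F`, and `v = log G` satisfies `|v| ≤ log F`.

Linear part. Let `P` be the conditional expectation under the density `m_v`. The entropy inequality
gives `|Pf|/c ≤ log E[e^{|f|/c} | X_t] + η` with `η` the conditional entropy of `m_v`, so for `b <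
1` the modular of `bPf` at scale `c` is at most `b` times that of `f` plus a constant free of `c`
(`EntropicDensity.exists_modular_tilt_le`). Hence the powers of `dP` are uniformly bounded for each
`d` in `(0,1)`, and the Neumann series of `I - βP` converges. The entropy lies in the heart since `η
≤ log E[m_v² | X_t]` and the normalizing constant of `m_v` has logarithm `v/β`.

Uniqueness. By convexity of `log E[exp]`, two fixed points satisfy `(v-w)⁺ ≤ βP(v-w)⁺`; the bound
above then makes all modulars of `(v-w)⁺` bounded uniformly in the scale, which forces `(v-w)⁺ = 0`.
-/

noncomputable section

namespace ThinTail

/-! ### Modular estimates and completeness of the Orlicz heart -/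

section OrliczLemmas

variable {S : Type*} [MeasurableSpace S] {μ : Measure S} {s : ℝ} {f g : S → ℝ}

theorem modular_mono (hs : 1 ≤ s) (h : ∀ᵐ x ∂μ, |f x| ≤ |g x|) {c : ℝ} (hc : 0 < c) :
    modular μ s f c ≤ modular μ s g c := by
  refine lintegral_mono_ae ?_
  filter_upwards [h] with x hx
  exact ENNReal.ofReal_le_ofReal (phi_mono hs (by positivity) (by gcongr))

theorem modular_anti (hs : 1 ≤ s) {c d : ℝ} (hc : 0 < c) (hcd : c ≤ d) :
    modular μ s f d ≤ modular μ s f c := by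
  refine lintegral_mono fun x => ENNReal.ofReal_le_ofReal (phi_mono hs ?_ (by gcongr))
  have : 0 < d := hc.trans_le hcd
  positivity

/-- Convexity and `φ_s(0) = 0` give `φ_s(x/B) ≤ φ_s(x)/B`. This is how a modular bound larger than
`1` is converted into a norm bound. -/
theorem modular_mul_le (hs : 1 ≤ s) {B c : ℝ} (hB : 1 ≤ B) (hc : 0 < c) :
    modular μ s f (B * c) ≤ ENNReal.ofReal B⁻¹ * modular μ s f c := by
  simp only [modular]
  rw [← lintegral_const_mul' _ _ ENNReal.ofReal_ne_top]
  refine lintegral_mono fun x => ?_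
  have hB0 : 0 < B := by linarith
  change ENNReal.ofReal _ ≤ ENNReal.ofReal _ * ENNReal.ofReal _
  rw [← ENNReal.ofReal_mul (by positivity)]
  refine ENNReal.ofReal_le_ofReal ?_
  have := phi_mul_le (s := s) (a := B⁻¹) (x := |f x| / c) hs (by positivity)
    (inv_le_one_of_one_le₀ hB) (by positivity)
  convert this using 2
  field_simp

theorem luxNorm_le_of_modular_le (hs : 1 ≤ s) {B c : ℝ} (hB : 1 ≤ B) (hc : 0 < c)
    (h : modular μ s f c ≤ ENNReal.ofReal B) : luxNorm μ s f ≤ ENNReal.ofReal (B * c) := by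
  have hB0 : 0 < B := by linarith
  refine luxNorm_le (by positivity) ((modular_mul_le hs hB hc).trans ?_)
  calc _ ≤ ENNReal.ofReal B⁻¹ * ENNReal.ofReal B := by gcongr
    _ = 1 := by
      rw [← ENNReal.ofReal_mul (by positivity), inv_mul_cancel₀ hB0.ne', ENNReal.ofReal_one]

theorem modular_le_one_of_luxNorm_lt (hs : 1 ≤ s) {c : ℝ} (h : luxNorm μ s f < ENNReal.ofReal c) :
    modular μ s f c ≤ 1 := by
  obtain ⟨d, hd, h1, h2⟩ := exists_of_luxNorm_lt h
  exact (modular_anti hs hd ((ENNReal.ofReal_lt_ofReal_iff_of_nonneg hd.le).1 h2).le).trans h1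

theorem luxNorm_lt_top_of_modular (hs : 1 ≤ s) {c : ℝ} (hc : 0 < c) (h : modular μ s f c < ∞) :
    luxNorm μ s f < ∞ := by
  refine (luxNorm_le_of_modular_le (B := max 1 (modular μ s f c).toReal) hs (le_max_left _ _)
    hc ?_).trans_lt ENNReal.ofReal_lt_top
  exact (ENNReal.le_ofReal_iff_toReal_le h.ne (by positivity)).2 (le_max_right _ _)

theorem memHeart_iff (hs : 1 ≤ s) :
    MemHeart μ s f ↔ AEStronglyMeasurable f μ ∧ ∀ c : ℝ, 0 < c → modular μ s f c < ∞ :=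
  ⟨fun h => ⟨h.1.1, h.2⟩, fun h =>
    ⟨⟨h.1, luxNorm_lt_top_of_modular hs one_pos (h.2 1 one_pos)⟩, h.2⟩⟩

theorem MemHeart.mono (hs : 1 ≤ s) (hg : MemHeart μ s g) (hf : AEStronglyMeasurable f μ)
    (h : ∀ᵐ x ∂μ, |f x| ≤ |g x|) : MemHeart μ s f :=
  (memHeart_iff hs).2 ⟨hf, fun c hc => (modular_mono hs h hc).trans_lt (hg.2 c hc)⟩

theorem MemHeart.abs (hs : 1 ≤ s) (hf : MemHeart μ s f) : MemHeart μ s (fun x => |f x|) :=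
  hf.mono hs (continuous_abs.comp_aestronglyMeasurable hf.1.1) (by simp)

theorem MemHeart.sub (hs : 1 ≤ s) (hf : MemHeart μ s f) (hg : MemHeart μ s g) :
    MemHeart μ s (fun x => f x - g x) := by
  have := hf.add hs (hg.smul hs (-1))
  simpa [sub_eq_add_neg] using this

/-- Below `1` the powers are ordered the wrong way, but there `φ_s` is at most `e`; the additive
constant is harmless for a finite measure. -/
theorem phi_le_of_le {s r x : ℝ} (hs : 0 ≤ s) (hsr : s ≤ r) (hx : 0 ≤ x) :
    phi s x ≤ Real.exp 1 + phi r x := by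
  have h0 := Real.exp_pos 1
  have h2 : 0 ≤ phi r x := phi_nonneg hx
  rcases le_total x 1 with h | h
  · have : x ^ s ≤ 1 := Real.rpow_le_one hx h hs
    have := Real.exp_le_exp.2 this
    simp only [phi] at *
    linarith
  · have := Real.exp_le_exp.2 (Real.rpow_le_rpow_of_exponent_le h hsr)
    simp only [phi] at *
    linarith

theorem exp_le_phi {s x : ℝ} (hs : 1 ≤ s) (hx : 0 ≤ x) :
    Real.exp x ≤ Real.exp 1 + 1 + phi s x := by
  have h := phi_le_of_le zero_le_one hs hx
  simp only [phi, Real.rpow_one] at *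
  linarith

theorem MemHeart.of_le [IsFiniteMeasure μ] {r : ℝ} (hs : 1 ≤ s) (hsr : s ≤ r)
    (hf : MemHeart μ r f) : MemHeart μ s f := by
  refine (memHeart_iff hs).2 ⟨hf.1.1, fun c hc => ?_⟩
  calc modular μ s f c
      ≤ ∫⁻ x, (ENNReal.ofReal (Real.exp 1) + ENNReal.ofReal (phi r (|f x| / c))) ∂μ := by
        refine lintegral_mono fun x => ?_
        change ENNReal.ofReal _ ≤ ENNReal.ofReal _ + ENNReal.ofReal _
        rw [← ENNReal.ofReal_add (Real.exp_pos _).le (phi_nonneg (by positivity))]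
        exact ENNReal.ofReal_le_ofReal (phi_le_of_le (by linarith) hsr (by positivity))
    _ = ENNReal.ofReal (Real.exp 1) * μ Set.univ + modular μ r f c := by
        rw [lintegral_add_left measurable_const, lintegral_const]; rfl
    _ < ∞ := ENNReal.add_lt_top.2
        ⟨ENNReal.mul_lt_top ENNReal.ofReal_lt_top (measure_lt_top _ _), hf.2 c hc⟩

theorem lintegral_exp_le [IsProbabilityMeasure μ] (hs : 1 ≤ s) {c : ℝ} (hc : 0 < c) :
    ∫⁻ x, ENNReal.ofReal (Real.exp (|f x| / c)) ∂μ ≤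
      ENNReal.ofReal (Real.exp 1 + 1) + modular μ s f c := by
  calc _ ≤ ∫⁻ x, (ENNReal.ofReal (Real.exp 1 + 1) + ENNReal.ofReal (phi s (|f x| / c))) ∂μ := by
        refine lintegral_mono fun x => ?_
        change ENNReal.ofReal _ ≤ ENNReal.ofReal _ + ENNReal.ofReal _
        rw [← ENNReal.ofReal_add (by positivity) (phi_nonneg (by positivity))]
        exact ENNReal.ofReal_le_ofReal (exp_le_phi hs (by positivity))
    _ = _ := by
        rw [lintegral_add_left measurable_const, lintegral_const]; simp [modular]

theorem integrable_exp_of_modular_lt_top [IsProbabilityMeasure μ] (hs : 1 ≤ s)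
    (hf : AEStronglyMeasurable f μ) {c : ℝ} (hc : 0 < c) (h : modular μ s f c < ∞) :
    Integrable (fun x => Real.exp (|f x| / c)) μ := by
  have hm : AEStronglyMeasurable (fun x => Real.exp (|f x| / c)) μ :=
    (Real.measurable_exp.comp_aemeasurable
      ((continuous_abs.measurable.comp_aemeasurable hf.aemeasurable).div_const c)).aestronglyMeasurable
  refine ⟨hm, ?_⟩
  rw [hasFiniteIntegral_iff_ofReal (Filter.Eventually.of_forall fun x => (Real.exp_pos _).le)]
  exact (lintegral_exp_le hs hc).trans_lt (ENNReal.add_lt_top.2 ⟨ENNReal.ofReal_lt_top, h⟩)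

theorem MemHeart.integrable_exp_abs [IsProbabilityMeasure μ] (hs : 1 ≤ s)
    (hf : MemHeart μ s f) : Integrable (fun x => Real.exp |f x|) μ := by
  simpa using integrable_exp_of_modular_lt_top hs hf.1.1 one_pos (hf.2 1 one_pos)

theorem MemHeart.integrable_exp [IsProbabilityMeasure μ] (hs : 1 ≤ s)
    (hf : MemHeart μ s f) : Integrable (fun x => Real.exp (f x)) μ := by
  refine (hf.integrable_exp_abs hs).mono'
    (Real.measurable_exp.comp_aemeasurable hf.1.1.aemeasurable).aestronglyMeasurable ?_
  refine Filter.Eventually.of_forall fun x => ?_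
  rw [Real.norm_eq_abs, abs_of_pos (Real.exp_pos _)]
  exact Real.exp_le_exp.2 (le_abs_self _)

theorem MemHeart.integrable [IsProbabilityMeasure μ] (hs : 1 ≤ s)
    (hf : MemHeart μ s f) : Integrable f μ := by
  refine (hf.integrable_exp_abs hs).mono' hf.1.1 (Filter.Eventually.of_forall fun x => ?_)
  rw [Real.norm_eq_abs]
  linarith [Real.add_one_le_exp |f x|]

/-- Supplies a limit candidate for Cauchy sequences of the heart. It follows from `|f|/c ≤
e^{|f|/c}`, whose integral is at most `e + 2` when the modular at `c` is at most `1`. -/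
theorem eLpNorm_one_le_luxNorm [IsProbabilityMeasure μ] (hs : 1 ≤ s) :
    eLpNorm f 1 μ ≤ ENNReal.ofReal (Real.exp 1 + 2) * luxNorm μ s f := by
  have h0 : ENNReal.ofReal (Real.exp 1 + 2) ≠ 0 := by
    simpa using by positivity
  simp only [luxNorm]
  rw [ENNReal.mul_iInf_of_ne h0 ENNReal.ofReal_ne_top]
  refine le_iInf fun c => ?_
  rw [ENNReal.mul_iInf_of_ne h0 ENNReal.ofReal_ne_top]
  refine le_iInf fun hc => ?_
  rw [ENNReal.mul_iInf_of_ne h0 ENNReal.ofReal_ne_top]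
  refine le_iInf fun h => ?_
  have h1 : ∫⁻ x, ENNReal.ofReal (Real.exp (|f x| / c)) ∂μ ≤ ENNReal.ofReal (Real.exp 1 + 2) := by
    refine (lintegral_exp_le hs hc).trans ?_
    calc _ ≤ ENNReal.ofReal (Real.exp 1 + 1) + 1 := by gcongr
      _ = _ := by
        rw [← ENNReal.ofReal_one, ← ENNReal.ofReal_add (by positivity) zero_le_one]
        congr 1; ring
  rw [eLpNorm_one_eq_lintegral_enorm]
  calc _ ≤ ∫⁻ x, ENNReal.ofReal (Real.exp (|f x| / c)) * ENNReal.ofReal c ∂μ := by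
        refine lintegral_mono fun x => ?_
        change _ ≤ ENNReal.ofReal _ * ENNReal.ofReal _
        rw [← ENNReal.ofReal_mul (Real.exp_pos _).le, Real.enorm_eq_ofReal_abs]
        refine ENNReal.ofReal_le_ofReal ?_
        rw [← div_le_iff₀ hc]
        linarith [Real.add_one_le_exp (|f x| / c)]
    _ = (∫⁻ x, ENNReal.ofReal (Real.exp (|f x| / c)) ∂μ) * ENNReal.ofReal c :=
        lintegral_mul_const' _ _ ENNReal.ofReal_ne_top
    _ ≤ _ := by gcongr

theorem continuous_phi (hs : 1 ≤ s) : Continuous (phi s) := by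
  unfold phi
  exact (Real.continuous_exp.comp (Real.continuous_rpow_const (by linarith))).sub continuous_const

theorem modular_le_of_tendsto (hs : 1 ≤ s) {F : ℕ → S → ℝ}
    (hF : ∀ n, AEStronglyMeasurable (F n) μ)
    (hlim : ∀ᵐ x ∂μ, Filter.Tendsto (fun n => F n x) Filter.atTop (nhds (f x)))
    {c : ℝ} {B : ℝ≥0∞} (hB : ∀ᶠ n in Filter.atTop, modular μ s (F n) c ≤ B) :
    modular μ s f c ≤ B := by
  have key : modular μ s f c ≤ Filter.liminf (fun n => modular μ s (F n) c) Filter.atTop := by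
    refine le_trans (le_of_eq ?_) (lintegral_liminf_le' fun n => aemeasurable_modular (hF n) c)
    refine lintegral_congr_ae ?_
    filter_upwards [hlim] with x hx
    refine (Filter.Tendsto.liminf_eq ?_).symm
    refine (ENNReal.continuous_ofReal.tendsto _).comp
      (((continuous_phi hs).tendsto _).comp ((hx.abs).div_const c))
  exact key.trans (Filter.liminf_le_of_frequently_le' hB.frequently)

theorem luxNorm_le_of_tendsto (hs : 1 ≤ s) {F : ℕ → S → ℝ}
    (hF : ∀ n, AEStronglyMeasurable (F n) μ)
    (hlim : ∀ᵐ x ∂μ, Filter.Tendsto (fun n => F n x) Filter.atTop (nhds (f x)))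
    {c : ℝ} (hc : 0 < c) (hB : ∀ᶠ n in Filter.atTop, luxNorm μ s (F n) < ENNReal.ofReal c) :
    luxNorm μ s f ≤ ENNReal.ofReal c :=
  luxNorm_le hc (modular_le_of_tendsto hs hF hlim
    (hB.mono fun _ hn => modular_le_one_of_luxNorm_lt hs hn))

theorem OrliczHeart.coeFn_sub [Fact (1 ≤ s)] (f g : OrliczHeart μ s) :
    ((f - g : OrliczHeart μ s) : S →ₘ[μ] ℝ) =ᵐ[μ]
      fun x => (f : S →ₘ[μ] ℝ) x - (g : S →ₘ[μ] ℝ) x := by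
  rw [Submodule.coe_sub]
  exact AEEqFun.coeFn_sub _ _

/-- A Cauchy sequence is also Cauchy in `L¹`, so a subsequence converges a.e.; Fatou's lemma for the
modular upgrades this to convergence in norm. Completeness is needed for the Neumann series. -/
instance completeSpace_orliczHeart [IsProbabilityMeasure μ] [hs : Fact (1 ≤ s)] :
    CompleteSpace (OrliczHeart μ s) := by
  refine Metric.complete_of_cauchySeq_tendsto fun a ha => ?_
  have hint : ∀ n, MemLp (a n : S →ₘ[μ] ℝ) 1 μ := fun n =>
    memLp_one_iff_integrable.2 ((a n).2.integrable hs.out)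
  have hlux : ∀ f : OrliczHeart μ s, luxNorm μ s (f : S →ₘ[μ] ℝ) = ENNReal.ofReal ‖f‖ := fun f => by
    rw [norm_def, ENNReal.ofReal_toReal f.2.1.2.ne]
  have hcau : CauchySeq fun n => (hint n).toLp := by
    rw [Metric.cauchySeq_iff] at ha ⊢
    intro ε hε
    have hK : 0 < Real.exp 1 + 2 := by positivity
    obtain ⟨N, hN⟩ := ha (ε / (Real.exp 1 + 2)) (by positivity)
    refine ⟨N, fun m hm n hn => ?_⟩
    have h1 := hN m hm n hn
    rw [dist_eq_norm] at h1 ⊢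
    rw [← MemLp.toLp_sub, Lp.norm_toLp]
    have h2 : eLpNorm ((a m : S →ₘ[μ] ℝ) - (a n : S →ₘ[μ] ℝ) : S → ℝ) 1 μ ≤
        ENNReal.ofReal ((Real.exp 1 + 2) * ‖a m - a n‖) := by
      refine (eLpNorm_one_le_luxNorm hs.out).trans ?_
      rw [ENNReal.ofReal_mul hK.le, ← hlux]
      gcongr
      exact (luxNorm_congr (OrliczHeart.coeFn_sub (a m) (a n)).symm).le
    refine (ENNReal.toReal_le_of_le_ofReal (by positivity) h2).trans_lt ?_
    rw [lt_div_iff₀ hK] at h1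
    linarith
  obtain ⟨l, hl⟩ := cauchySeq_tendsto_of_complete hcau
  obtain ⟨ns, hns, hae⟩ := (tendstoInMeasure_of_tendsto_Lp hl).exists_seq_tendsto_ae
  have hae' : ∀ᵐ x ∂μ, Filter.Tendsto (fun k => (a (ns k) : S →ₘ[μ] ℝ) x) Filter.atTop
      (nhds (l x)) := by
    have := ae_all_iff.2 fun n => (hint n).coeFn_toLp
    filter_upwards [hae, this] with x hx h
    simpa [h] using hx
  have key : ∀ ε : ℝ, 0 < ε → ∃ N, ∀ n ≥ N,
      luxNorm μ s (fun x => (a n : S →ₘ[μ] ℝ) x - l x) ≤ ENNReal.ofReal ε := by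
    intro ε hε
    obtain ⟨N, hN⟩ := Metric.cauchySeq_iff.1 ha ε hε
    refine ⟨N, fun n hn => luxNorm_le_of_tendsto hs.out
      (F := fun k x => (a n : S →ₘ[μ] ℝ) x - (a (ns k) : S →ₘ[μ] ℝ) x)
      (fun k => (a n).2.1.1.sub (a (ns k)).2.1.1) ?_ hε ?_⟩
    · filter_upwards [hae'] with x hx
      exact tendsto_const_nhds.sub hx
    · filter_upwards [hns.tendsto_atTop.eventually_ge_atTop N] with k hk
      rw [← luxNorm_congr (OrliczHeart.coeFn_sub (a n) (a (ns k))), hlux,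
        ENNReal.ofReal_lt_ofReal_iff hε, ← dist_eq_norm]
      exact hN n hn _ hk
  -- The heart is closed: write `l = a_N - (a_N - l)` and split the scale `c` into halves. The first
  -- term has finite modular at every scale, and the second has norm at most `c/4 < c/2`.
  have hlm : MemHeart μ s l := by
    refine (memHeart_iff hs.out).2 ⟨(Lp.aestronglyMeasurable l), fun c hc => ?_⟩
    obtain ⟨N, hN⟩ := key (c / 4) (by positivity)
    have h1 := hN N le_rfl
    have h2 : modular μ s (fun x => (a N : S →ₘ[μ] ℝ) x - l x) (c / 2) ≤ 1 :=
      modular_le_one_of_luxNorm_lt hs.out (h1.trans_lt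
        ((ENNReal.ofReal_lt_ofReal_iff (by positivity)).2 (by linarith)))
    have h3 := modular_add_le (f := fun x => (a N : S →ₘ[μ] ℝ) x)
      (g := fun x => -1 * ((a N : S →ₘ[μ] ℝ) x - l x)) hs.out
      (a N).2.1.1 (half_pos hc) (half_pos hc)
    rw [add_halves, modular_smul (by norm_num)] at h3
    have e : (fun x => (a N : S →ₘ[μ] ℝ) x + -1 * ((a N : S →ₘ[μ] ℝ) x - l x)) = l := by
      funext x; ring
    rw [e] at h3
    refine h3.trans_lt (ENNReal.add_lt_top.2
      ⟨ENNReal.mul_lt_top ENNReal.ofReal_lt_top ((a N).2.2 _ (half_pos hc)),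
        ENNReal.mul_lt_top ENNReal.ofReal_lt_top ?_⟩)
    simpa using h2.trans_lt ENNReal.one_lt_top
  refine ⟨⟨(l : S →ₘ[μ] ℝ), hlm⟩, Metric.tendsto_atTop.2 fun ε hε => ?_⟩
  obtain ⟨N, hN⟩ := key (ε / 2) (by positivity)
  refine ⟨N, fun n hn => ?_⟩
  rw [dist_eq_norm, norm_def, luxNorm_congr (OrliczHeart.coeFn_sub _ _)]
  refine (ENNReal.toReal_le_of_le_ofReal (by positivity) (hN n hn)).trans_lt (by linarith)

end OrliczLemmas

/-! ### Jensen's inequality for `φ_s ∘ log` -/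

section LogExp

/-- The tangent line of `y ↦ y^s` at `L`, obtained from Bernoulli's inequality for `y/L`. -/
theorem rpow_tangent_le {s L y : ℝ} (hs : 1 ≤ s) (hL : 0 < L) (hy : 0 ≤ y) :
    L ^ s + s * L ^ (s - 1) * (y - L) ≤ y ^ s := by
  have h := one_add_mul_self_le_rpow_one_add (s := y / L - 1) (p := s)
    (by have : 0 ≤ y / L := by positivity
        linarith) hs
  have h1 : 0 < L ^ s := Real.rpow_pos_of_pos hL s
  have h2 : (1 + (y / L - 1)) ^ s * L ^ s = y ^ s := by
    rw [← Real.mul_rpow (by ring_nf; positivity) hL.le]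
    congr 1
    field_simp
    ring
  have h3 : L ^ s = L ^ (s - 1) * L := by
    rw [← Real.rpow_add_one hL.ne']
    congr 1
    ring
  calc L ^ s + s * L ^ (s - 1) * (y - L) = (1 + s * (y / L - 1)) * L ^ s := by
        rw [h3]; field_simp
    _ ≤ (1 + (y / L - 1)) ^ s * L ^ s := by gcongr
    _ = y ^ s := h2

theorem ofReal_phi_add_one {s x : ℝ} (hx : 0 ≤ x) :
    ENNReal.ofReal (phi s x) + 1 = ENNReal.ofReal (Real.exp (x ^ s)) := by
  rw [← ENNReal.ofReal_one, ← ENNReal.ofReal_add (phi_nonneg hx) zero_le_one]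
  simp [phi]

variable {Y : Type*} [MeasurableSpace Y]

theorem rpow_lintegral_exp_le {ν : Measure Y} [IsProbabilityMeasure ν] {g : Y → ℝ}
    (hg : AEMeasurable g ν) {p : ℝ} (hp : 1 ≤ p) :
    (∫⁻ y, ENNReal.ofReal (Real.exp (g y)) ∂ν) ^ p ≤
      ∫⁻ y, ENNReal.ofReal (Real.exp (p * g y)) ∂ν := by
  have hp0 : 0 < p := by linarith
  have h := eLpNorm'_le_eLpNorm'_of_exponent_le one_pos hp ν
    (Real.measurable_exp.comp_aemeasurable hg).aestronglyMeasurable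
  simp only [eLpNorm', Function.comp_apply, ENNReal.rpow_one, div_one] at h
  have h' := ENNReal.rpow_le_rpow h hp0.le
  rw [← ENNReal.rpow_mul, one_div_mul_cancel hp0.ne', ENNReal.rpow_one] at h'
  have e1 : ∀ y, ‖Real.exp (g y)‖ₑ = ENNReal.ofReal (Real.exp (g y)) := fun y =>
    Real.enorm_of_nonneg (Real.exp_pos _).le
  have e2 : ∀ y, ENNReal.ofReal (Real.exp (g y)) ^ p = ENNReal.ofReal (Real.exp (p * g y)) :=
    fun y => by rw [ENNReal.ofReal_rpow_of_pos (Real.exp_pos _), ← Real.exp_mul, mul_comm]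
  simpa only [e1, e2] using h'

theorem one_le_lintegral_exp {ν : Measure Y} [IsProbabilityMeasure ν] {g : Y → ℝ}
    (h0 : ∀ y, 0 ≤ g y) : 1 ≤ ∫⁻ y, ENNReal.ofReal (Real.exp (g y)) ∂ν := by
  calc (1 : ℝ≥0∞) = ∫⁻ _, 1 ∂ν := by simp
    _ ≤ _ := lintegral_mono fun y => ENNReal.one_le_ofReal.2 (Real.one_le_exp (h0 y))

theorem log_lintegral_exp_nonneg {ν : Measure Y} [IsProbabilityMeasure ν] {g : Y → ℝ}
    (h0 : ∀ y, 0 ≤ g y) :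
    0 ≤ Real.log (∫⁻ y, ENNReal.ofReal (Real.exp (g y)) ∂ν).toReal := by
  rcases eq_or_ne (∫⁻ y, ENNReal.ofReal (Real.exp (g y)) ∂ν) ∞ with h | h
  · simp [h]
  · refine Real.log_nonneg ?_
    simpa using ENNReal.toReal_mono h (one_le_lintegral_exp h0)

/-- The quantity is the slope of `y ↦ (y/c)^s` at `L`. For `s > 1` it grows without bound, whatever
`c`; for `s = 1` it is the constant `1/c`. -/
theorem exists_one_le_slope {s c : ℝ} (hc : 0 < c) (h : 1 < s ∨ s = 1 ∧ c = 1) :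
    ∃ L₀ : ℝ, 0 ≤ L₀ ∧ ∀ L, L₀ < L → 1 ≤ s * L ^ (s - 1) / c ^ s := by
  rcases h with h | ⟨rfl, rfl⟩
  · obtain ⟨L₀, h0⟩ := Filter.eventually_atTop.1
      ((tendsto_rpow_atTop (show 0 < s - 1 by linarith)).eventually_ge_atTop (c ^ s / s))
    refine ⟨max L₀ 0, le_max_right _ _, fun L hL => ?_⟩
    have h1 := h0 L ((le_max_left _ _).trans hL.le)
    have hs : 0 < s := by linarith
    rw [div_le_iff₀ hs] at h1
    rw [le_div_iff₀ (by positivity)]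
    linarith
  · exact ⟨0, le_rfl, fun L _ => by simp⟩

/-- A conditional Jensen inequality for `φ_s ∘ log`, which is convex near infinity. -/
theorem exists_phi_log_lintegral_exp_le {s c : ℝ} (hc : 0 < c) (h : 1 < s ∨ s = 1 ∧ c = 1) :
    ∃ C : ℝ, 0 ≤ C ∧ ∀ (ν : Measure Y) [IsProbabilityMeasure ν] (g : Y → ℝ), AEMeasurable g ν →
      (∀ y, 0 ≤ g y) →
      ENNReal.ofReal (phi s (Real.log (∫⁻ y, ENNReal.ofReal (Real.exp (g y)) ∂ν).toReal / c)) ≤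
        ENNReal.ofReal C + ∫⁻ y, ENNReal.ofReal (phi s (g y / c)) ∂ν := by
  have hs : 1 ≤ s := h.elim le_of_lt fun h => h.1.ge
  obtain ⟨L₀, hL₀, hslope⟩ := exists_one_le_slope hc h
  refine ⟨phi s (L₀ / c), phi_nonneg (by positivity), fun ν _ g hg h0 => ?_⟩
  set Z := ∫⁻ y, ENNReal.ofReal (Real.exp (g y)) ∂ν with hZ
  set L := Real.log Z.toReal with hL
  have hL0 : 0 ≤ L := log_lintegral_exp_nonneg h0
  -- Small `L` is absorbed by the constant, which does not depend on `ν`. The case `Z = ∞` also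
  -- falls here, since then `Z.toReal = 0` and `L = 0`.
  rcases le_or_gt L L₀ with hle | hlt
  · exact le_add_right (ENNReal.ofReal_le_ofReal (phi_mono hs (by positivity) (by gcongr)))
  have hLpos : 0 < L := hL₀.trans_lt hlt
  have hZt : Z ≠ ∞ := by
    intro hZt
    simp [hL, hZt] at hLpos
  have hZ1 : 1 ≤ Z := one_le_lintegral_exp h0
  have hZexp : Z = ENNReal.ofReal (Real.exp L) := by
    rw [hL, Real.exp_log (ENNReal.toReal_pos (by positivity) hZt), ENNReal.ofReal_toReal hZt]
  -- The line `y ↦ p y - κ` is tangent to `(y/c)^s` at `y = L`. As `p ≥ 1`, Jensen applies to the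
  -- power `p`, and the tangent bound turns `E[e^{pg}]` into `E[e^{(g/c)^s}]` with no loss at `L`.
  set p := s * L ^ (s - 1) / c ^ s with hp
  have hp1 : 1 ≤ p := hslope L hlt
  have hjensen := rpow_lintegral_exp_le hg hp1
  rw [← hZ, hZexp, ENNReal.ofReal_rpow_of_pos (Real.exp_pos _), ← Real.exp_mul] at hjensen
  set κ := p * L - (L / c) ^ s with hκ
  have hcs : 0 < c ^ s := Real.rpow_pos_of_pos hc s
  have hline : ∀ y, p * g y ≤ κ + (g y / c) ^ s := fun y => by
    have ht := rpow_tangent_le hs hLpos (h0 y)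
    rw [hκ, Real.div_rpow hLpos.le hc.le, Real.div_rpow (h0 y) hc.le, hp]
    have := div_le_div_of_nonneg_right ht hcs.le
    have e : (L ^ s + s * L ^ (s - 1) * (g y - L)) / c ^ s =
        L ^ s / c ^ s + s * L ^ (s - 1) / c ^ s * g y - s * L ^ (s - 1) / c ^ s * L := by
      field_simp
      ring
    rw [e] at this
    linarith
  have hmain : ENNReal.ofReal (Real.exp ((L / c) ^ s)) ≤
      ∫⁻ y, ENNReal.ofReal (Real.exp ((g y / c) ^ s)) ∂ν := by
    have h1 : ENNReal.ofReal (Real.exp (L * p)) ≤ ENNReal.ofReal (Real.exp κ) *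
        ∫⁻ y, ENNReal.ofReal (Real.exp ((g y / c) ^ s)) ∂ν := by
      rw [← lintegral_const_mul' _ _ ENNReal.ofReal_ne_top]
      refine hjensen.trans (lintegral_mono fun y => ?_)
      change _ ≤ ENNReal.ofReal _ * ENNReal.ofReal _
      rw [← ENNReal.ofReal_mul (Real.exp_pos _).le, ← Real.exp_add]
      exact ENNReal.ofReal_le_ofReal (Real.exp_le_exp.2 (hline y))
    calc _ = ENNReal.ofReal (Real.exp (-κ)) * ENNReal.ofReal (Real.exp (L * p)) := by
          rw [← ENNReal.ofReal_mul (Real.exp_pos _).le, ← Real.exp_add]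
          congr 2
          rw [hκ]; ring
      _ ≤ ENNReal.ofReal (Real.exp (-κ)) * (ENNReal.ofReal (Real.exp κ) *
          ∫⁻ y, ENNReal.ofReal (Real.exp ((g y / c) ^ s)) ∂ν) := by gcongr
      _ = _ := by
          rw [← mul_assoc, ← ENNReal.ofReal_mul (Real.exp_pos _).le, ← Real.exp_add]
          simp
  refine le_add_left ?_
  rw [← ENNReal.add_le_add_iff_right ENNReal.one_ne_top,
    ofReal_phi_add_one (by positivity)]
  refine hmain.trans (le_of_eq ?_)
  calc _ = ∫⁻ y, (ENNReal.ofReal (phi s (g y / c)) + 1) ∂ν := by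
        refine lintegral_congr fun y => ?_
        rw [ofReal_phi_add_one (div_nonneg (h0 y) hc.le)]
    _ = _ := by
        rw [lintegral_add_right _ measurable_const]
        simp

end LogExp

/-! ### From modular bounds to operator bounds -/

section Norm

variable {S : Type*} [MeasurableSpace S] {μ : Measure S} {s : ℝ}

theorem norm_le_of_modular_le [hs : Fact (1 ≤ s)] {f : OrliczHeart μ s} {B : ℝ} (hB : 1 ≤ B)
    (h : modular μ s (f : S →ₘ[μ] ℝ) 1 ≤ ENNReal.ofReal B) : ‖f‖ ≤ B := by
  have := luxNorm_le_of_modular_le hs.out hB one_pos h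
  rw [mul_one] at this
  exact ENNReal.toReal_le_of_le_ofReal (by linarith) this

theorem modular_le_one_of_norm_lt [hs : Fact (1 ≤ s)] {f : OrliczHeart μ s} (h : ‖f‖ < 1) :
    modular μ s (f : S →ₘ[μ] ℝ) 1 ≤ 1 := by
  refine modular_le_one_of_luxNorm_lt hs.out ?_
  rw [← ENNReal.ofReal_toReal f.2.1.2.ne]
  exact (ENNReal.ofReal_lt_ofReal_iff one_pos).2 h

/-- The open unit ball is used because norm `< 1` gives modular `≤ 1` without asking whether the
infimum is attained. Scaling `z` to norm `1/2` costs the factor `2`. -/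
theorem norm_le_mul_of_forall_lt_one {E F : Type*} [NormedAddCommGroup E] [NormedSpace ℝ E]
    [NormedAddCommGroup F] [NormedSpace ℝ F] (T : E →ₗ[ℝ] F) {M : ℝ}
    (h : ∀ z, ‖z‖ < 1 → ‖T z‖ ≤ M) (z : E) : ‖T z‖ ≤ 2 * M * ‖z‖ := by
  rcases eq_or_ne z 0 with rfl | hz
  · simp
  have hz' : 0 < ‖z‖ := norm_pos_iff.2 hz
  have h1 := h ((2 * ‖z‖)⁻¹ • z) (by
    rw [norm_smul, norm_inv, Real.norm_of_nonneg (by positivity)]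
    field_simp
    norm_num)
  rw [map_smul, norm_smul, norm_inv, Real.norm_of_nonneg (by positivity),
    inv_mul_le_iff₀ (by positivity)] at h1
  linarith

end Norm

/-! ### The entropy inequality -/

section EntropyInequality

/-- The Fenchel–Young inequality for the conjugate pair `k log k - k` and `exp`. -/
theorem mul_le_mul_log_add_exp {k a : ℝ} (hk : 0 ≤ k) :
    k * a ≤ k * Real.log k - k + Real.exp a := by
  rcases hk.eq_or_lt with rfl | hk
  · simp [(Real.exp_pos a).le]
  have h := Real.add_one_le_exp (a - Real.log k)
  rw [Real.exp_sub, Real.exp_log hk, le_div_iff₀ hk] at h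
  linarith

variable {Y : Type*} [MeasurableSpace Y] {ν : Measure Y} {k a : Y → ℝ}

theorem integrable_mul_of_entropy (hk0 : ∀ y, 0 ≤ k y) (hk : Integrable k ν)
    (hent : Integrable (fun y => k y * Real.log (k y)) ν) (ha : AEStronglyMeasurable a ν)
    (hexp : Integrable (fun y => Real.exp |a y|) ν) : Integrable (fun y => k y * a y) ν := by
  refine ((hent.sub hk).add hexp).mono' (hk.1.mul ha) (Filter.Eventually.of_forall fun y => ?_)
  rw [Real.norm_eq_abs, abs_mul, abs_of_nonneg (hk0 y)]
  exact mul_le_mul_log_add_exp (hk0 y)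

/-- The entropy inequality `E[k |a|] ≤ log E[exp |a|] + E[k log k]` for a density `k`. -/
theorem abs_integral_mul_le_log_add_entropy [IsProbabilityMeasure ν] (hk0 : ∀ y, 0 ≤ k y)
    (hk : Integrable k ν) (hk1 : ∫ y, k y ∂ν = 1)
    (hent : Integrable (fun y => k y * Real.log (k y)) ν) (ha : AEStronglyMeasurable a ν)
    (hexp : Integrable (fun y => Real.exp |a y|) ν) :
    |∫ y, k y * a y ∂ν| ≤
      Real.log (∫ y, Real.exp |a y| ∂ν) + ∫ y, k y * Real.log (k y) ∂ν := by
  have hka := integrable_mul_of_entropy hk0 hk hent (a := fun y => |a y|)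
    (continuous_abs.comp_aestronglyMeasurable ha) (by simpa using hexp)
  have h1 : |∫ y, k y * a y ∂ν| ≤ ∫ y, k y * |a y| ∂ν := by
    refine (abs_integral_le_integral_abs).trans_eq (integral_congr_ae
      (Filter.Eventually.of_forall fun y => ?_))
    simp only [abs_mul, abs_of_nonneg (hk0 y)]
  have hpos : 0 < ∫ y, Real.exp |a y| ∂ν := integral_exp_pos hexp
  set L := Real.log (∫ y, Real.exp |a y| ∂ν) with hL
  -- Fenchel–Young is applied to `|a| - L`: this choice of `L` makes the exponential term integrate
  -- to `1`, which cancels `∫ k = 1`.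
  have h2 : ∫ y, (k y * |a y| - L * k y) ∂ν ≤
      ∫ y, (k y * Real.log (k y) - k y + Real.exp (-L) * Real.exp |a y|) ∂ν := by
    refine integral_mono (hka.sub (hk.const_mul L)) ((hent.sub hk).add (hexp.const_mul _))
      fun y => ?_
    have := mul_le_mul_log_add_exp (a := |a y| - L) (hk0 y)
    rw [sub_eq_add_neg |a y|, add_comm |a y|, Real.exp_add] at this
    change k y * |a y| - L * k y ≤ _
    linarith
  have h3 : ∫ y, (k y * Real.log (k y) - k y + Real.exp (-L) * Real.exp |a y|) ∂ν =
      ∫ y, k y * Real.log (k y) ∂ν := by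
    rw [integral_add (f := fun y => k y * Real.log (k y) - k y) (hent.sub hk) (hexp.const_mul _),
      integral_sub hent hk, hk1, integral_const_mul, Real.exp_neg, hL, Real.exp_log hpos,
      inv_mul_cancel₀ hpos.ne', sub_add_cancel]
  rw [h3, integral_sub hka (hk.const_mul L), integral_const_mul, hk1] at h2
  linarith

theorem entropy_nonneg [IsProbabilityMeasure ν] (hk0 : ∀ y, 0 ≤ k y)
    (hk : Integrable k ν) (hk1 : ∫ y, k y ∂ν = 1)
    (hent : Integrable (fun y => k y * Real.log (k y)) ν) :
    0 ≤ ∫ y, k y * Real.log (k y) ∂ν := by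
  have h : ∫ y, (k y - 1) ∂ν ≤ ∫ y, k y * Real.log (k y) ∂ν := by
    refine integral_mono (hk.sub (integrable_const _)) hent fun y => ?_
    have := mul_le_mul_log_add_exp (a := 0) (hk0 y)
    simp only [mul_zero, Real.exp_zero] at this
    change k y - 1 ≤ _
    linarith
  rw [integral_sub hk (integrable_const _), hk1] at h
  simpa using h

end EntropyInequality

/-! ### Discounted tilted expectations on the Orlicz heart -/

section Tilt

variable {X : Type*} [MeasurableSpace X]

/-- A transition density with respect to `Q`, with finite conditional entropy. -/
structure EntropicDensity (Q₀ : Measure X) (Q : Kernel X X) (k : X → X → ℝ) : Prop where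
  measurable : Measurable (Function.uncurry k)
  nonneg : ∀ x y, 0 ≤ k x y
  integrable : ∀ᵐ x ∂Q₀, Integrable (k x) (Q x)
  integral_eq_one : ∀ᵐ x ∂Q₀, ∫ y, k x y ∂(Q x) = 1
  integrable_entropy : ∀ᵐ x ∂Q₀, Integrable (fun y => k x y * Real.log (k x y)) (Q x)

/-- The conditional expectation operator of the transition density `k`. -/
def tilt (Q : Kernel X X) (k : X → X → ℝ) (f : X → ℝ) (x : X) : ℝ := ∫ y, k x y * f y ∂(Q x)

/-- The conditional entropy of the transition density `k`. -/
def relEntropy (Q : Kernel X X) (k : X → X → ℝ) (x : X) : ℝ :=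
  ∫ y, k x y * Real.log (k x y) ∂(Q x)

variable {Q₀ : Measure X} {Q : Kernel X X} {k : X → X → ℝ} {s : ℝ} {f g : X → ℝ}

/-- By stationarity `Q₀`-null sets are `Q x`-null for almost every `x`, so functions may be changed
to versions inside conditional expectations. -/
theorem ae_ae_of_invariant (hQ : Kernel.Invariant Q Q₀) {p : X → Prop} (h : ∀ᵐ y ∂Q₀, p y) :
    ∀ᵐ x ∂Q₀, ∀ᵐ y ∂(Q x), p y :=
  Measure.ae_ae_of_ae_comp (by rwa [hQ.def])

theorem lintegral_lintegral_of_invariant (hQ : Kernel.Invariant Q Q₀) {F : X → ℝ≥0∞}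
    (hF : AEMeasurable F Q₀) : ∫⁻ x, ∫⁻ y, F y ∂(Q x) ∂Q₀ = ∫⁻ y, F y ∂Q₀ := by
  have h := Measure.lintegral_bind (m := Q₀) (μ := Q) (f := F) Q.measurable.aemeasurable
    (by rwa [hQ.def])
  rw [hQ.def] at h
  exact h.symm

theorem aestronglyMeasurable_of_invariant (hQ : Kernel.Invariant Q Q₀)
    (hf : AEStronglyMeasurable f Q₀) : ∀ᵐ x ∂Q₀, AEStronglyMeasurable f (Q x) := by
  filter_upwards [ae_ae_of_invariant hQ hf.ae_eq_mk] with x hx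
  exact ⟨_, hf.stronglyMeasurable_mk, hx⟩

theorem tilt_congr (hQ : Kernel.Invariant Q Q₀) (h : f =ᵐ[Q₀] g) :
    tilt Q k f =ᵐ[Q₀] tilt Q k g := by
  filter_upwards [ae_ae_of_invariant hQ h] with x hx
  refine integral_congr_ae ?_
  filter_upwards [hx] with y hy
  rw [hy]

theorem coeFn_smul_tilt [hs : Fact (1 ≤ s)]
    {P : OrliczHeart Q₀ s →L[ℝ] OrliczHeart Q₀ s}
    (hP : ∀ f : OrliczHeart Q₀ s, (P f : X →ₘ[Q₀] ℝ) =ᵐ[Q₀] tilt Q k (f : X →ₘ[Q₀] ℝ)) (b : ℝ)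
    (f : OrliczHeart Q₀ s) : ((b • P) f : X →ₘ[Q₀] ℝ) =ᵐ[Q₀]
      fun x => b * tilt Q k (f : X →ₘ[Q₀] ℝ) x := by
  rw [_root_.smul_apply, Submodule.coe_smul]
  filter_upwards [AEEqFun.coeFn_smul b (P f : X →ₘ[Q₀] ℝ), hP f] with x h1 h2
  rw [h1, Pi.smul_apply, h2, smul_eq_mul]

variable [IsMarkovKernel Q]

theorem EntropicDensity.stronglyMeasurable_tilt (hk : EntropicDensity Q₀ Q k)
    (hf : StronglyMeasurable f) : StronglyMeasurable (tilt Q k f) := by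
  refine StronglyMeasurable.integral_kernel_prod_right' (f := fun p : X × X => k p.1 p.2 * f p.2) ?_
  exact hk.measurable.stronglyMeasurable.mul (hf.comp_measurable measurable_snd)

theorem EntropicDensity.aestronglyMeasurable_tilt (hk : EntropicDensity Q₀ Q k)
    (hQ : Kernel.Invariant Q Q₀) (hf : AEStronglyMeasurable f Q₀) :
    AEStronglyMeasurable (tilt Q k f) Q₀ :=
  ⟨_, hk.stronglyMeasurable_tilt hf.stronglyMeasurable_mk, tilt_congr hQ hf.ae_eq_mk⟩

theorem ae_integrable_exp_of_modular (hQ : Kernel.Invariant Q Q₀) (hs : 1 ≤ s)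
    (hf : AEStronglyMeasurable f Q₀) {c : ℝ} (hc : 0 < c) (h : modular Q₀ s f c < ∞) :
    ∀ᵐ x ∂Q₀, Integrable (fun y => Real.exp (|f y| / c)) (Q x) := by
  have hm := aemeasurable_modular (s := s) hf c
  rw [modular, ← lintegral_lintegral_of_invariant hQ hm] at h
  have h2 : ∀ᵐ x ∂Q₀, ∫⁻ y, ENNReal.ofReal (phi s (|f y| / c)) ∂(Q x) < ∞ := by
    refine ae_lt_top' ?_ h.ne
    have hfm := hf.ae_eq_mk
    refine ⟨fun x => ∫⁻ y, ENNReal.ofReal (phi s (|hf.mk f y| / c)) ∂(Q x), ?_, ?_⟩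
    · refine Measurable.lintegral_kernel ?_
      exact ((measurable_phi s).comp ((continuous_abs.measurable.comp
        hf.stronglyMeasurable_mk.measurable).div_const c)).ennreal_ofReal
    · filter_upwards [ae_ae_of_invariant hQ hfm] with x hx
      refine lintegral_congr_ae ?_
      filter_upwards [hx] with y hy
      rw [hy]
  filter_upwards [h2, aestronglyMeasurable_of_invariant hQ hf] with x hx hxm
  exact integrable_exp_of_modular_lt_top hs hxm hc hx

theorem EntropicDensity.integrable_mul (hk : EntropicDensity Q₀ Q k)
    (hQ : Kernel.Invariant Q Q₀) (hs : 1 ≤ s) (hf : MemHeart Q₀ s f) :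
    ∀ᵐ x ∂Q₀, Integrable (fun y => k x y * f y) (Q x) := by
  filter_upwards [ae_integrable_exp_of_modular hQ hs hf.1.1 one_pos (hf.2 1 one_pos),
    aestronglyMeasurable_of_invariant hQ hf.1.1, hk.integrable, hk.integrable_entropy]
    with x h1 h2 h3 h4
  exact integrable_mul_of_entropy (hk.nonneg x) h3 h4 h2 (by simpa using h1)

theorem lintegral_ofReal_exp {Y : Type*} [MeasurableSpace Y] {ν : Measure Y} {a : Y → ℝ}
    (h : Integrable (fun y => Real.exp (a y)) ν) :
    (∫⁻ y, ENNReal.ofReal (Real.exp (a y)) ∂ν).toReal = ∫ y, Real.exp (a y) ∂ν := by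
  rw [integral_eq_lintegral_of_nonneg_ae (Filter.Eventually.of_forall fun y => (Real.exp_pos _).le)
    h.1]

theorem EntropicDensity.abs_tilt_le (hk : EntropicDensity Q₀ Q k) (hQ : Kernel.Invariant Q Q₀)
    (hs : 1 ≤ s) (hf : AEStronglyMeasurable f Q₀) {c : ℝ} (hc : 0 < c)
    (h : modular Q₀ s f c < ∞) :
    ∀ᵐ x ∂Q₀, |tilt Q k f x| / c ≤
      Real.log (∫⁻ y, ENNReal.ofReal (Real.exp (|f y| / c)) ∂(Q x)).toReal + relEntropy Q k x := by
  filter_upwards [ae_integrable_exp_of_modular hQ hs hf hc h,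
    aestronglyMeasurable_of_invariant hQ hf, hk.integrable, hk.integral_eq_one,
    hk.integrable_entropy] with x h1 h2 h3 h4 h5
  have e : ∀ y, |f y / c| = |f y| / c := fun y => by rw [abs_div, abs_of_pos hc]
  have key := abs_integral_mul_le_log_add_entropy (a := fun y => f y / c) (hk.nonneg x) h3 h4 h5
    (h2.aemeasurable.div_const c).aestronglyMeasurable (by simpa only [e] using h1)
  simp only [e] at key
  rw [lintegral_ofReal_exp h1]
  refine le_trans (le_of_eq ?_) key
  have : ∫ y, k x y * (f y / c) ∂(Q x) = tilt Q k f x / c := by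
    rw [tilt, ← integral_div]
    simp only [mul_div_assoc]
  rw [this, abs_div, abs_of_pos hc]

variable [IsProbabilityMeasure Q₀]

/-- A discounted tilted expectation contracts the modular at every scale `c`, up to a constant
that does not depend on `c`. -/
theorem EntropicDensity.exists_modular_tilt_le (hk : EntropicDensity Q₀ Q k)
    (hQ : Kernel.Invariant Q Q₀) (hs : 1 ≤ s) (hent : MemHeart Q₀ s (relEntropy Q k))
    {b : ℝ} (hb0 : 0 < b) (hb1 : b < 1) :
    ∃ B : ℝ, 0 ≤ B ∧ ∀ (f : X → ℝ) (c : ℝ), AEStronglyMeasurable f Q₀ → 0 < c →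
      modular Q₀ s (fun x => b * tilt Q k f x) c ≤
        ENNReal.ofReal b * modular Q₀ s f c + ENNReal.ofReal B := by
  -- Jensen is used at scale `1` only, with `|f|/c` as the integrand. Thus `C` is independent of
  -- `c`, and `s = 1` is allowed.
  obtain ⟨C, hC0, hC⟩ := exists_phi_log_lintegral_exp_le (Y := X) (s := s) one_pos
    (hs.lt_or_eq.imp id fun h => ⟨h.symm, rfl⟩)
  simp only [div_one] at hC
  have hb1' : 0 < 1 - b := by linarith
  -- The factor comes from the convex combination `b(Λ + η) = bΛ + (1-b)·(b/(1-b))η`. The entropy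
  -- `η` is not divided by `c`, so `K` does not depend on `c` either.
  set K := modular Q₀ s (fun x => b / (1 - b) * relEntropy Q k x) 1 with hK
  have hKt : K < ∞ := (hent.smul hs _).2 1 one_pos
  refine ⟨b * C + (1 - b) * K.toReal, by positivity, fun f c hf hc => ?_⟩
  rcases eq_or_ne (modular Q₀ s f c) ∞ with htop | htop
  · rw [htop, ENNReal.mul_top (by simpa using hb0)]
    simp
  have hm := aemeasurable_modular (s := s) hf c
  have hkm : AEMeasurable (fun x => ENNReal.ofReal (phi s (|b / (1 - b) * relEntropy Q k x| / 1)))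
      Q₀ := aemeasurable_modular (hent.1.1.const_mul _) 1
  have hpt : ∀ᵐ x ∂Q₀, ENNReal.ofReal (phi s (|b * tilt Q k f x| / c)) ≤
      ENNReal.ofReal (1 - b) * ENNReal.ofReal (phi s (|b / (1 - b) * relEntropy Q k x| / 1)) +
      ENNReal.ofReal b * (ENNReal.ofReal C + ∫⁻ y, ENNReal.ofReal (phi s (|f y| / c)) ∂(Q x)) := by
    filter_upwards [hk.abs_tilt_le hQ hs hf hc htop.lt_top,
      aestronglyMeasurable_of_invariant hQ hf, hk.integrable, hk.integral_eq_one,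
      hk.integrable_entropy] with x h1 h2 h3 h4 h5
    have hη : 0 ≤ relEntropy Q k x := entropy_nonneg (hk.nonneg x) h3 h4 h5
    have hg0 : ∀ y, 0 ≤ |f y| / c := fun y => by positivity
    set Λ := Real.log (∫⁻ y, ENNReal.ofReal (Real.exp (|f y| / c)) ∂(Q x)).toReal with hΛ
    have hΛ0 : 0 ≤ Λ := log_lintegral_exp_nonneg hg0
    have hκ : 0 ≤ |b / (1 - b) * relEntropy Q k x| / 1 := by positivity
    have hbd : phi s (|b * tilt Q k f x| / c) ≤
        (1 - b) * phi s (|b / (1 - b) * relEntropy Q k x| / 1) + b * phi s Λ := by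
      refine le_trans (phi_mono hs (by positivity) ?_)
        (phi_convex hs hb1'.le hb0.le (by ring) hκ hΛ0)
      rw [abs_mul b, abs_of_pos hb0, abs_of_nonneg (mul_nonneg (by positivity) hη : 0 ≤
        b / (1 - b) * relEntropy Q k x), mul_div_assoc]
      calc _ ≤ b * (Λ + relEntropy Q k x) := by gcongr
        _ = _ := by field_simp; ring
    refine (ENNReal.ofReal_le_ofReal hbd).trans ?_
    rw [ENNReal.ofReal_add (mul_nonneg hb1'.le (phi_nonneg hκ))
      (mul_nonneg hb0.le (phi_nonneg hΛ0)), ENNReal.ofReal_mul hb1'.le, ENNReal.ofReal_mul hb0.le]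
    gcongr
    exact hC (Q x) _ ((continuous_abs.measurable.comp_aemeasurable h2.aemeasurable).div_const c) hg0
  calc modular Q₀ s (fun x => b * tilt Q k f x) c
      ≤ ∫⁻ x, (ENNReal.ofReal (1 - b) *
          ENNReal.ofReal (phi s (|b / (1 - b) * relEntropy Q k x| / 1)) + ENNReal.ofReal b *
          (ENNReal.ofReal C + ∫⁻ y, ENNReal.ofReal (phi s (|f y| / c)) ∂(Q x))) ∂Q₀ :=
        lintegral_mono_ae hpt
    _ = ENNReal.ofReal (1 - b) * K + ENNReal.ofReal b *
          (ENNReal.ofReal C + modular Q₀ s f c) := by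
        rw [lintegral_add_left' (hkm.const_mul _), lintegral_const_mul' _ _ ENNReal.ofReal_ne_top,
          lintegral_const_mul' _ _ ENNReal.ofReal_ne_top, lintegral_add_left measurable_const,
          lintegral_lintegral_of_invariant hQ hm]
        simp [hK, modular]
    _ = _ := by
        rw [ENNReal.ofReal_add (by positivity) (by positivity), ENNReal.ofReal_mul hb0.le,
          ENNReal.ofReal_mul hb1'.le, ENNReal.ofReal_toReal hKt.ne]
        ring

theorem EntropicDensity.memHeart_tilt (hk : EntropicDensity Q₀ Q k)
    (hQ : Kernel.Invariant Q Q₀) (hs : 1 ≤ s) (hent : MemHeart Q₀ s (relEntropy Q k))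
    (hf : MemHeart Q₀ s f) : MemHeart Q₀ s (tilt Q k f) := by
  obtain ⟨B, -, hB⟩ := hk.exists_modular_tilt_le hQ hs hent (b := 1 / 2) (by norm_num) (by norm_num)
  have h : MemHeart Q₀ s (fun x => 1 / 2 * tilt Q k f x) :=
    (memHeart_iff hs).2 ⟨(hk.aestronglyMeasurable_tilt hQ hf.1.1).const_mul _, fun c hc =>
      (hB f c hf.1.1 hc).trans_lt (ENNReal.add_lt_top.2
        ⟨ENNReal.mul_lt_top ENNReal.ofReal_lt_top (hf.2 c hc), ENNReal.ofReal_lt_top⟩)⟩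
  have := h.smul hs 2
  simpa [← mul_assoc] using this

/-- A nonnegative function dominated by its own discounted tilted expectation vanishes. -/
theorem EntropicDensity.ae_eq_zero_of_le_tilt (hk : EntropicDensity Q₀ Q k)
    (hQ : Kernel.Invariant Q Q₀) (hs : 1 ≤ s) (hent : MemHeart Q₀ s (relEntropy Q k))
    {b : ℝ} (hb0 : 0 < b) (hb1 : b < 1) (hf : MemHeart Q₀ s f) (hf0 : ∀ᵐ x ∂Q₀, 0 ≤ f x)
    (hle : ∀ᵐ x ∂Q₀, f x ≤ b * tilt Q k f x) : f =ᵐ[Q₀] fun _ => 0 := by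
  obtain ⟨B, hB0, hB⟩ := hk.exists_modular_tilt_le hQ hs hent hb0 hb1
  have hb1' : 0 < 1 - b := by linarith
  set M := max 1 (B / (1 - b)) with hM
  have hM0 : 0 < M := lt_of_lt_of_le one_pos (le_max_left _ _)
  -- Membership in the heart makes the modular finite at every `c`, so the term with factor `b` can
  -- be moved to the left. A bound uniform in `c` then gives norm at most `ε` by taking `c = ε/M`.
  have hmod : ∀ c, 0 < c → modular Q₀ s f c ≤ ENNReal.ofReal M := fun c hc => by
    have hfin := (hf.2 c hc).ne
    have h1 : modular Q₀ s f c ≤ ENNReal.ofReal b * modular Q₀ s f c + ENNReal.ofReal B := by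
      refine le_trans (modular_mono hs ?_ hc) (hB f c hf.1.1 hc)
      filter_upwards [hf0, hle] with x h0 h1
      rwa [abs_of_nonneg h0, abs_of_nonneg (h0.trans h1)]
    rw [← ENNReal.ofReal_toReal hfin, ← ENNReal.ofReal_mul hb0.le,
      ← ENNReal.ofReal_add (by positivity) hB0,
      ENNReal.ofReal_le_ofReal_iff (by positivity)] at h1
    refine (ENNReal.le_ofReal_iff_toReal_le hfin hM0.le).2 (le_trans ?_ (le_max_right _ _))
    rw [le_div_iff₀ hb1']
    linarith
  refine ae_eq_zero_of_luxNorm hs hf.1.1 (le_antisymm ?_ bot_le)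
  refine ENNReal.le_of_forall_pos_le_add fun ε hε _ => ?_
  have hε' : (0 : ℝ) < ε := by exact_mod_cast hε
  have := luxNorm_le_of_modular_le (B := M) (c := ε / M) hs (le_max_left _ _) (by positivity)
    (hmod _ (by positivity))
  rw [mul_div_cancel₀ _ hM0.ne'] at this
  simpa using this

/-- The tilted conditional expectation as a linear map of the Orlicz heart. -/
def EntropicDensity.tiltLinear [hs : Fact (1 ≤ s)] (hk : EntropicDensity Q₀ Q k)
    (hQ : Kernel.Invariant Q Q₀) (hent : MemHeart Q₀ s (relEntropy Q k)) :
    OrliczHeart Q₀ s →ₗ[ℝ] OrliczHeart Q₀ s where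
  toFun f := ⟨AEEqFun.mk (tilt Q k (f : X →ₘ[Q₀] ℝ)) (hk.aestronglyMeasurable_tilt hQ f.2.1.1),
    (hk.memHeart_tilt hQ hs.out hent f.2).congr (AEEqFun.coeFn_mk _ _).symm⟩
  map_add' f g := by
    refine Subtype.ext (AEEqFun.ext ?_)
    refine (AEEqFun.coeFn_mk _ _).trans (Filter.EventuallyEq.trans ?_ (AEEqFun.coeFn_add _ _).symm)
    filter_upwards [hk.integrable_mul hQ hs.out f.2, hk.integrable_mul hQ hs.out g.2,
      AEEqFun.coeFn_mk _ (hk.aestronglyMeasurable_tilt hQ f.2.1.1),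
      AEEqFun.coeFn_mk _ (hk.aestronglyMeasurable_tilt hQ g.2.1.1),
      tilt_congr (k := k) hQ (AEEqFun.coeFn_add (f : X →ₘ[Q₀] ℝ) (g : X →ₘ[Q₀] ℝ))]
      with x h1 h2 h3 h4 h5
    rw [Pi.add_apply, h3, h4]
    refine h5.trans ?_
    simp only [tilt, Pi.add_apply, mul_add]
    exact integral_add h1 h2
  map_smul' a f := by
    refine Subtype.ext (AEEqFun.ext ?_)
    refine (AEEqFun.coeFn_mk _ _).trans (Filter.EventuallyEq.trans ?_ (AEEqFun.coeFn_smul _ _).symm)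
    filter_upwards [AEEqFun.coeFn_mk _ (hk.aestronglyMeasurable_tilt hQ f.2.1.1),
      tilt_congr (k := k) hQ (AEEqFun.coeFn_smul a (f : X →ₘ[Q₀] ℝ))] with x h3 h5
    rw [Pi.smul_apply, h3]
    refine h5.trans ?_
    simp only [tilt, Pi.smul_apply, smul_eq_mul, RingHom.id_apply]
    rw [← integral_const_mul]
    congr 1
    funext y
    ring

/-- The tilted conditional expectation as a bounded operator of the Orlicz heart. -/
theorem EntropicDensity.exists_tiltCLM [hs : Fact (1 ≤ s)] (hk : EntropicDensity Q₀ Q k)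
    (hQ : Kernel.Invariant Q Q₀) (hent : MemHeart Q₀ s (relEntropy Q k)) :
    ∃ P : OrliczHeart Q₀ s →L[ℝ] OrliczHeart Q₀ s, ∀ f : OrliczHeart Q₀ s,
      (P f : X →ₘ[Q₀] ℝ) =ᵐ[Q₀] tilt Q k (f : X →ₘ[Q₀] ℝ) := by
  have hP : ∀ f : OrliczHeart Q₀ s, (hk.tiltLinear hQ hent f : X →ₘ[Q₀] ℝ) =ᵐ[Q₀]
      tilt Q k (f : X →ₘ[Q₀] ℝ) := fun f => AEEqFun.coeFn_mk _ _
  obtain ⟨B, hB0, hB⟩ := hk.exists_modular_tilt_le hQ hs.out hent (b := 1 / 2) (by norm_num)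
    (by norm_num)
  have hbd : ∀ z : OrliczHeart Q₀ s, ‖z‖ < 1 → ‖hk.tiltLinear hQ hent z‖ ≤ 2 * (1 + B) := by
    intro z hz
    have h1 : modular Q₀ s (((1 / 2 : ℝ) • hk.tiltLinear hQ hent z : OrliczHeart Q₀ s) :
        X →ₘ[Q₀] ℝ) 1 ≤ ENNReal.ofReal (1 + B) := by
      have e : (((1 / 2 : ℝ) • hk.tiltLinear hQ hent z : OrliczHeart Q₀ s) : X →ₘ[Q₀] ℝ) =ᵐ[Q₀]
          fun x => 1 / 2 * tilt Q k (z : X →ₘ[Q₀] ℝ) x := by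
        rw [Submodule.coe_smul]
        filter_upwards [AEEqFun.coeFn_smul (1 / 2 : ℝ) (hk.tiltLinear hQ hent z : X →ₘ[Q₀] ℝ),
          hP z] with x h1 h2
        rw [h1, Pi.smul_apply, h2, smul_eq_mul]
      rw [modular_congr e]
      refine (hB z 1 z.2.1.1 one_pos).trans ?_
      rw [ENNReal.ofReal_add zero_le_one hB0, ENNReal.ofReal_one]
      gcongr
      exact mul_le_one' (ENNReal.ofReal_le_one.2 (by norm_num)) (modular_le_one_of_norm_lt hz)
    have h2 := norm_le_of_modular_le (by linarith) h1
    rw [norm_smul, Real.norm_of_nonneg (by norm_num)] at h2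
    linarith
  exact ⟨(hk.tiltLinear hQ hent).mkContinuous _ (norm_le_mul_of_forall_lt_one _ hbd), hP⟩

/-- `I - b P` is invertible on the Orlicz heart for every discount factor `b < 1`. -/
theorem EntropicDensity.isUnit_one_sub_smul [hs : Fact (1 ≤ s)] (hk : EntropicDensity Q₀ Q k)
    (hQ : Kernel.Invariant Q Q₀) (hent : MemHeart Q₀ s (relEntropy Q k))
    {P : OrliczHeart Q₀ s →L[ℝ] OrliczHeart Q₀ s}
    (hP : ∀ f : OrliczHeart Q₀ s, (P f : X →ₘ[Q₀] ℝ) =ᵐ[Q₀] tilt Q k (f : X →ₘ[Q₀] ℝ))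
    {b : ℝ} (hb0 : 0 < b) (hb1 : b < 1) : IsUnit (1 - b • P) := by
  -- The powers of `d • P` will be uniformly bounded, which leaves the geometric factor `(b/d)^n`
  -- for the series in `b • P`.
  obtain ⟨d, hbd, hd1⟩ := exists_between hb1
  have hd0 : 0 < d := hb0.trans hbd
  obtain ⟨B, hB0, hB⟩ := hk.exists_modular_tilt_le hQ hs.out hent hd0 hd1
  have hd1' : 0 < 1 - d := by linarith
  -- Chosen so that `M ≥ 1` and `dM + B ≤ M`: the modular bound `M` holds on the open unit ball and
  -- is preserved by `d • P`.
  set M := 1 + B / (1 - d) with hM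
  have hM1 : 1 ≤ M := by
    have : 0 ≤ B / (1 - d) := by positivity
    linarith
  have hMB : d * M + B ≤ M := by
    have : B = (1 - d) * (B / (1 - d)) := by field_simp
    nlinarith
  have hiter : ∀ (z : OrliczHeart Q₀ s), ‖z‖ < 1 → ∀ n : ℕ,
      modular Q₀ s (((d • P) ^ n) z : X →ₘ[Q₀] ℝ) 1 ≤ ENNReal.ofReal M := by
    intro z hz n
    induction n with
    | zero =>
      rw [pow_zero]
      exact (modular_le_one_of_norm_lt hz).trans (ENNReal.one_le_ofReal.2 hM1)
    | succ n ih =>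
      rw [pow_succ']
      change modular Q₀ s (((d • P) (((d • P) ^ n) z) : OrliczHeart Q₀ s) : X →ₘ[Q₀] ℝ) 1 ≤ _
      rw [modular_congr (coeFn_smul_tilt hP d _)]
      refine (hB _ 1 (((d • P) ^ n) z).2.1.1 one_pos).trans ?_
      calc _ ≤ ENNReal.ofReal d * ENNReal.ofReal M + ENNReal.ofReal B := by gcongr
        _ = ENNReal.ofReal (d * M + B) := by
          rw [ENNReal.ofReal_add (by positivity) hB0, ENNReal.ofReal_mul hd0.le]
        _ ≤ _ := ENNReal.ofReal_le_ofReal hMB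
  have hnorm : ∀ n : ℕ, ‖(d • P) ^ n‖ ≤ 2 * M := fun n =>
    ContinuousLinearMap.opNorm_le_bound _ (by linarith)
      (norm_le_mul_of_forall_lt_one (((d • P) ^ n : OrliczHeart Q₀ s →L[ℝ] OrliczHeart Q₀ s) :
        OrliczHeart Q₀ s →ₗ[ℝ] OrliczHeart Q₀ s)
        fun z hz => norm_le_of_modular_le hM1 (hiter z hz n))
  have hsum : Summable fun n : ℕ => (b • P) ^ n := by
    refine Summable.of_norm_bounded (g := fun n : ℕ => (b / d) ^ n * (2 * M))
      ((summable_geometric_of_lt_one (by positivity) ((div_lt_one hd0).2 hbd)).mul_right _)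
      fun n => ?_
    have e : b • P = (b / d) • (d • P) := by
      rw [smul_smul, div_mul_cancel₀ _ hd0.ne']
    rw [e, smul_pow, norm_smul, Real.norm_of_nonneg (by positivity)]
    gcongr
    exact hnorm n
  exact ⟨⟨1 - b • P, ∑' n : ℕ, (b • P) ^ n, hsum.one_sub_mul_tsum_pow,
    hsum.tsum_pow_mul_one_sub⟩, rfl⟩

end Tilt

/-! ### Logarithms of conditional exponential moments -/

section LogConditionalExp

variable {X : Type*} [MeasurableSpace X] {Q₀ : Measure X} [IsProbabilityMeasure Q₀]
  {Q : Kernel X X} [IsMarkovKernel Q] {s : ℝ} {f : X → ℝ} {w : X × X → ℝ}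

theorem map_snd_compProd_of_invariant (hQ : Kernel.Invariant Q Q₀) :
    (Q₀ ⊗ₘ Q).map Prod.snd = Q₀ := by
  have h := Measure.snd_compProd Q₀ Q
  rwa [hQ.def] at h

theorem modular_comp_snd (hQ : Kernel.Invariant Q Q₀) (hf : AEStronglyMeasurable f Q₀) (c : ℝ) :
    modular (Q₀ ⊗ₘ Q) s (fun p => f p.2) c = modular Q₀ s f c := by
  have h := lintegral_map' (μ := Q₀ ⊗ₘ Q) (g := Prod.snd)
    (f := fun x => ENNReal.ofReal (phi s (|f x| / c)))
    (by rw [map_snd_compProd_of_invariant hQ]; exact aemeasurable_modular hf c)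
    measurable_snd.aemeasurable
  rw [map_snd_compProd_of_invariant hQ] at h
  exact h.symm

theorem MemHeart.comp_snd (hQ : Kernel.Invariant Q Q₀) (hs : 1 ≤ s) (hf : MemHeart Q₀ s f) :
    MemHeart (Q₀ ⊗ₘ Q) s (fun p => f p.2) := by
  refine (memHeart_iff hs).2 ⟨?_, fun c hc => by rw [modular_comp_snd hQ hf.1.1]; exact hf.2 c hc⟩
  refine AEStronglyMeasurable.comp_measurable (g := f) ?_ measurable_snd
  rw [map_snd_compProd_of_invariant hQ]
  exact hf.1.1

theorem MemHeart.ae_integrable_exp (hs : 1 ≤ s) (hw : MemHeart (Q₀ ⊗ₘ Q) s w) :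
    ∀ᵐ x ∂Q₀, Integrable (fun y => Real.exp (w (x, y))) (Q x) := by
  have h := hw.integrable_exp hs
  exact ((Measure.integrable_compProd_iff h.1).1 h).1

/-- The logarithm of the conditional exponential moment of `|w|`. -/
def logCondExp (Q : Kernel X X) (w : X × X → ℝ) (x : X) : ℝ :=
  Real.log (∫⁻ y, ENNReal.ofReal (Real.exp |w (x, y)|) ∂(Q x)).toReal

theorem measurable_lintegral_exp (hw : Measurable w) :
    Measurable fun x => ∫⁻ y, ENNReal.ofReal (Real.exp (w (x, y))) ∂(Q x) :=
  Measurable.lintegral_kernel_prod_right' (κ := Q) (f := fun p => ENNReal.ofReal (Real.exp (w p)))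
    (Real.measurable_exp.comp hw).ennreal_ofReal

theorem measurable_logCondExp (hw : Measurable w) : Measurable (logCondExp Q w) :=
  Real.measurable_log.comp (measurable_lintegral_exp (w := fun p => |w p|)
    (continuous_abs.measurable.comp hw)).ennreal_toReal

theorem logCondExp_nonneg (x : X) : 0 ≤ logCondExp Q w x :=
  log_lintegral_exp_nonneg fun _ => abs_nonneg _

/-- Jensen under each `Q x`, integrated against `Q₀`. Here `C` may depend on `c`; having every scale
available is what requires `s > 1`. -/
theorem exists_modular_logCondExp_le (hs : 1 < s) {c : ℝ} (hc : 0 < c) :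
    ∃ C : ℝ, 0 ≤ C ∧ ∀ w : X × X → ℝ, Measurable w →
      modular Q₀ s (logCondExp Q w) c ≤ ENNReal.ofReal C + modular (Q₀ ⊗ₘ Q) s w c := by
  obtain ⟨C, hC0, hC⟩ := exists_phi_log_lintegral_exp_le (Y := X) (s := s) hc (Or.inl hs)
  refine ⟨C, hC0, fun w hw => ?_⟩
  have hwm : Measurable fun p => ENNReal.ofReal (phi s (|w p| / c)) :=
    ((measurable_phi s).comp ((continuous_abs.measurable.comp hw).div_const c)).ennreal_ofReal
  rw [modular, modular, Measure.lintegral_compProd hwm]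
  calc _ ≤ ∫⁻ x, (ENNReal.ofReal C + ∫⁻ y, ENNReal.ofReal (phi s (|w (x, y)| / c)) ∂(Q x)) ∂Q₀ := by
        refine lintegral_mono fun x => ?_
        rw [abs_of_nonneg (logCondExp_nonneg x)]
        exact hC (Q x) (fun y => |w (x, y)|)
          (continuous_abs.measurable.comp (hw.comp measurable_prodMk_left)).aemeasurable
          fun y => abs_nonneg _
    _ = _ := by
        rw [lintegral_add_left measurable_const]
        simp

theorem MemHeart.logCondExp (hs : 1 < s) (hw : Measurable w) (h : MemHeart (Q₀ ⊗ₘ Q) s w) :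
    MemHeart Q₀ s (logCondExp Q w) := by
  refine (memHeart_iff hs.le).2 ⟨(measurable_logCondExp hw).aestronglyMeasurable, fun c hc => ?_⟩
  obtain ⟨C, -, hC⟩ := exists_modular_logCondExp_le (Q₀ := Q₀) (Q := Q) hs hc
  exact (hC w hw).trans_lt (ENNReal.add_lt_top.2 ⟨ENNReal.ofReal_lt_top, h.2 c hc⟩)

end LogConditionalExp

/-! ### Existence by monotone iteration -/

section FixedPoint

variable {X : Type*} [MeasurableSpace X]

/-- The value recursion in exponential variables. -/
def expOp (Q : Kernel X X) (β : ℝ) (a : X × X → ℝ) (F : X → ℝ≥0∞) (x : X) : ℝ≥0∞ :=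
  (∫⁻ y, F y * ENNReal.ofReal (Real.exp (a (x, y))) ∂(Q x)) ^ β

variable {Q₀ : Measure X} {Q : Kernel X X} {β : ℝ} {a b : X × X → ℝ} {F G : X → ℝ≥0∞}

theorem expOp_mono (hβ : 0 < β) (hab : ∀ p, a p ≤ b p) (hFG : F ≤ G) :
    expOp Q β a F ≤ expOp Q β b G := fun _ =>
  ENNReal.rpow_le_rpow (lintegral_mono fun y =>
    mul_le_mul' (hFG y) (ENNReal.ofReal_le_ofReal (Real.exp_le_exp.2 (hab _)))) hβ.le

theorem measurable_expOp [IsSFiniteKernel Q] (ha : Measurable a) (hF : Measurable F) :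
    Measurable (expOp Q β a F) :=
  (Measurable.lintegral_kernel_prod_right' (κ := Q)
    (f := fun p => F p.2 * ENNReal.ofReal (Real.exp (a p)))
    ((hF.comp measurable_snd).mul (Real.measurable_exp.comp ha).ennreal_ofReal)).pow_const β

theorem measurable_iterate_expOp [IsSFiniteKernel Q] (ha : Measurable a) (hF : Measurable F)
    (n : ℕ) : Measurable ((expOp Q β a)^[n] F) := by
  induction n with
  | zero => exact hF
  | succ n ih => rw [Function.iterate_succ_apply']; exact measurable_expOp ha ih

theorem measurable_iSup_iterate_expOp [IsSFiniteKernel Q] (ha : Measurable a)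
    (hF : Measurable F) : Measurable (⨆ n, (expOp Q β a)^[n] F) := by
  have h : (⨆ n, (expOp Q β a)^[n] F) = fun x => ⨆ n, (expOp Q β a)^[n] F x := by
    funext x
    exact iSup_apply
  rw [h]
  exact Measurable.iSup (measurable_iterate_expOp ha hF)

theorem monotone_iterate_expOp (hβ : 0 < β) (hle : F ≤ expOp Q β a F) :
    Monotone fun n => (expOp Q β a)^[n] F :=
  Monotone.monotone_iterate_of_le_map (fun _ _ h => expOp_mono hβ (fun _ => le_rfl) h) hle

/-- Monotone convergence, together with `t ↦ t^β` being an order isomorphism of `[0,∞]`; no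
integrability is needed. -/
theorem expOp_iSup_iterate [IsSFiniteKernel Q] (hβ : 0 < β) (ha : Measurable a)
    (hF : Measurable F) (hle : F ≤ expOp Q β a F) :
    expOp Q β a (⨆ n, (expOp Q β a)^[n] F) = ⨆ n, (expOp Q β a)^[n] F := by
  have hmono := monotone_iterate_expOp hβ hle
  have h1 : expOp Q β a (⨆ n, (expOp Q β a)^[n] F) = ⨆ n, (expOp Q β a)^[n + 1] F := by
    funext x
    simp only [expOp, iSup_apply, ENNReal.iSup_mul]
    rw [lintegral_iSup]
    · have h := (ENNReal.orderIsoRpow β hβ).map_iSup fun n =>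
        ∫⁻ y, (expOp Q β a)^[n] F y * ENNReal.ofReal (Real.exp (a (x, y))) ∂(Q x)
      simp only [ENNReal.orderIsoRpow_apply] at h
      refine h.trans (iSup_congr fun n => ?_)
      rw [Function.iterate_succ_apply']
      rfl
    · exact fun n => (measurable_iterate_expOp ha hF n).mul
        (Real.measurable_exp.comp (ha.comp measurable_prodMk_left)).ennreal_ofReal
    · exact fun m n hmn y => mul_le_mul_left (hmono hmn y) _
  rw [h1]
  refine le_antisymm (iSup_le fun n => le_iSup (fun n => (expOp Q β a)^[n] F) (n + 1))
    (iSup_le fun n => ?_)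
  exact (hmono n.le_succ).trans (le_iSup (fun n => (expOp Q β a)^[n + 1] F) n)

variable [IsMarkovKernel Q]

theorem one_le_expOp_abs (hβ : 0 < β) (hF : 1 ≤ F) : 1 ≤ expOp Q β (fun p => |a p|) F := by
  intro x
  refine ENNReal.one_le_rpow ?_ hβ
  calc (1 : ℝ≥0∞) = ∫⁻ _, 1 ∂(Q x) := by simp
    _ ≤ _ := lintegral_mono fun y => one_le_mul (hF y)
      (ENNReal.one_le_ofReal.2 (Real.one_le_exp (abs_nonneg _)))

theorem one_le_iterate_expOp_abs (hβ : 0 < β) (n : ℕ) :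
    1 ≤ (expOp Q β (fun p => |a p|))^[n] 1 := by
  induction n with
  | zero => exact le_rfl
  | succ n ih => rw [Function.iterate_succ_apply']; exact one_le_expOp_abs hβ ih

theorem log_toReal_nonneg {z : ℝ≥0∞} (hz : 1 ≤ z) : 0 ≤ Real.log z.toReal := by
  rcases eq_or_ne z ∞ with rfl | h
  · simp
  · exact Real.log_nonneg (by simpa using ENNReal.toReal_mono h hz)

theorem ofReal_exp_log_toReal {z : ℝ≥0∞} (hz : z ≠ 0) (hz' : z ≠ ∞) :
    ENNReal.ofReal (Real.exp (Real.log z.toReal)) = z := by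
  rw [Real.exp_log (ENNReal.toReal_pos hz hz'), ENNReal.ofReal_toReal hz']

theorem lintegral_mul_exp_eq {F : X → ℝ≥0∞} {x : X} {ν : Measure X}
    (h : ∀ᵐ y ∂ν, F y ≠ 0 ∧ F y ≠ ∞) :
    ∫⁻ y, F y * ENNReal.ofReal (Real.exp (a (x, y))) ∂ν =
      ∫⁻ y, ENNReal.ofReal (Real.exp (Real.log (F y).toReal + a (x, y))) ∂ν := by
  refine lintegral_congr_ae ?_
  filter_upwards [h] with y hy
  rw [Real.exp_add, ENNReal.ofReal_mul (Real.exp_pos _).le, ofReal_exp_log_toReal hy.1 hy.2]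

variable [IsProbabilityMeasure Q₀]

theorem lintegral_exp_lt_top_of_memHeart {r : ℝ} (hr : 1 ≤ r) {w : X × X → ℝ}
    (hw : MemHeart (Q₀ ⊗ₘ Q) r w) :
    ∀ᵐ x ∂Q₀, ∫⁻ y, ENNReal.ofReal (Real.exp (w (x, y))) ∂(Q x) < ∞ := by
  filter_upwards [hw.ae_integrable_exp hr] with x hx
  have := hx.2
  rwa [hasFiniteIntegral_iff_ofReal (Filter.Eventually.of_forall fun y => (Real.exp_pos _).le)]
    at this

/-- Finiteness and the modular bound are carried together: a.e. finiteness is needed to write an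
iterate as the exponential of its logarithm, and the modular bound makes the next iterate finite. -/
theorem iterate_expOp_bound (hQ : Kernel.Invariant Q Q₀) (hβ₀ : 0 < β) {r : ℝ}
    (hr : 1 < r) (ha : Measurable a) (hh : MemHeart (Q₀ ⊗ₘ Q) r a) {D : ℝ → ℝ≥0∞}
    (hD : ∀ c, 0 < c → D c < ∞)
    (hstep : ∀ c, 0 < c → ∀ f : X → ℝ, Measurable f →
      modular Q₀ r f c ≤ D c →
      modular Q₀ r (fun x => β * logCondExp Q (fun p => f p.2 + |a p|) x) c ≤ D c) (n : ℕ) :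
    (∀ᵐ x ∂Q₀, (expOp Q β (fun p => |a p|))^[n] 1 x < ∞) ∧
      ∀ c, 0 < c → modular Q₀ r
        (fun x => Real.log ((expOp Q β (fun p => |a p|))^[n] 1 x).toReal) c ≤ D c := by
  induction n with
  | zero => simp [modular_zero hr.le]
  | succ n ih =>
    set F := (expOp Q β (fun p => |a p|))^[n] 1 with hF
    have hF1 : 1 ≤ F := one_le_iterate_expOp_abs hβ₀ n
    have habs : Measurable fun p => |a p| := continuous_abs.measurable.comp ha
    have hFm : Measurable F := measurable_iterate_expOp habs measurable_one n
    set f : X → ℝ := fun x => Real.log (F x).toReal with hf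
    have hfm : Measurable f := Real.measurable_log.comp hFm.ennreal_toReal
    have hf0 : ∀ x, 0 ≤ f x := fun x => log_toReal_nonneg (hF1 x)
    have hfh : MemHeart Q₀ r f := (memHeart_iff hr.le).2
      ⟨hfm.aestronglyMeasurable, fun c hc => (ih.2 c hc).trans_lt (hD c hc)⟩
    have hw : MemHeart (Q₀ ⊗ₘ Q) r (fun p => f p.2 + |a p|) :=
      (hfh.comp_snd hQ hr.le).add hr.le (hh.abs hr.le)
    have hint := lintegral_exp_lt_top_of_memHeart hr.le hw
    have heq : ∀ᵐ x ∂Q₀, expOp Q β (fun p => |a p|) F x =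
        (∫⁻ y, ENNReal.ofReal (Real.exp (f y + |a (x, y)|)) ∂(Q x)) ^ β := by
      filter_upwards [ae_ae_of_invariant hQ ih.1] with x hx
      rw [expOp, lintegral_mul_exp_eq (a := fun p => |a p|)]
      filter_upwards [hx] with y hy
      exact ⟨(zero_lt_one.trans_le (hF1 y)).ne', hy.ne⟩
    rw [Function.iterate_succ_apply', ← hF]
    refine ⟨?_, fun c hc => ?_⟩
    · filter_upwards [hint, heq] with x h1 h2
      rw [h2]
      exact ENNReal.rpow_lt_top_of_nonneg hβ₀.le h1.ne
    · refine le_trans (le_of_eq (modular_congr ?_ c)) (hstep c hc f hfm (ih.2 c hc))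
      filter_upwards [hint, heq] with x h1 h2
      have e : ∀ y, |(f y + |a (x, y)|)| = f y + |a (x, y)| := fun y =>
        abs_of_nonneg (add_nonneg (hf0 y) (abs_nonneg _))
      have hpos : 0 < (∫⁻ y, ENNReal.ofReal (Real.exp (f y + |a (x, y)|)) ∂(Q x)).toReal := by
        refine ENNReal.toReal_pos ?_ h1.ne
        exact (zero_lt_one.trans_le (one_le_lintegral_exp fun y =>
          add_nonneg (hf0 y) (abs_nonneg _))).ne'
      simp only [logCondExp, e]
      rw [h2, ← ENNReal.toReal_rpow, Real.log_rpow hpos]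

theorem exists_modular_bound (hQ : Kernel.Invariant Q Q₀) (hβ₀ : 0 < β) (hβ₁ : β < 1) {r : ℝ}
    (hr : 1 < r) (ha : Measurable a) (hh : MemHeart (Q₀ ⊗ₘ Q) r a) {c : ℝ} (hc : 0 < c) :
    ∃ D : ℝ≥0∞, D < ∞ ∧ ∀ f : X → ℝ, Measurable f → modular Q₀ r f c ≤ D →
      modular Q₀ r (fun x => β * logCondExp Q (fun p => f p.2 + |a p|) x) c ≤ D := by
  have hβ1' : 0 < 1 - β := by linarith
  -- The factor `β` changes the scale to `c/β = c + (1-β)c/β`. Splitting it this way gives `f` the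
  -- scale `c` with weight `β`, and `|a|` the weight `1-β`.
  obtain ⟨C, hC0, hC⟩ := exists_modular_logCondExp_le (Q₀ := Q₀) (Q := Q) hr
    (show 0 < c / β by positivity)
  set K := modular (Q₀ ⊗ₘ Q) r (fun p => |a p|) ((1 - β) * (c / β)) with hK
  have hKt : K < ∞ := (hh.abs hr.le).2 _ (by positivity)
  -- The solution of `D = C + βD + (1-β)K`.
  refine ⟨ENNReal.ofReal ((C + (1 - β) * K.toReal) / (1 - β)), ENNReal.ofReal_lt_top,
    fun f hf hfD => ?_⟩
  have hw : Measurable fun p : X × X => f p.2 + |a p| :=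
    (hf.comp measurable_snd).add (continuous_abs.measurable.comp ha)
  rw [modular_smul hβ₀.ne', abs_of_pos hβ₀]
  refine (hC _ hw).trans ?_
  have hadd := modular_add_le (μ := Q₀ ⊗ₘ Q) (f := fun p => f p.2) (g := fun p => |a p|) (c := c)
    (d := (1 - β) * (c / β)) hr.le (hf.comp measurable_snd).aestronglyMeasurable hc (by positivity)
  have e1 : c + (1 - β) * (c / β) = c / β := by field_simp; ring
  have e2 : c / (c / β) = β := by field_simp
  have e3 : (1 - β) * (c / β) / (c / β) = 1 - β := by field_simp
  rw [e1, e2, e3, modular_comp_snd hQ hf.aestronglyMeasurable, ← hK] at hadd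
  calc _ ≤ ENNReal.ofReal C + (ENNReal.ofReal β * ENNReal.ofReal ((C + (1 - β) * K.toReal) / (1 - β))
        + ENNReal.ofReal (1 - β) * ENNReal.ofReal K.toReal) := by
        gcongr
        refine hadd.trans ?_
        rw [ENNReal.ofReal_toReal hKt.ne]
        gcongr
    _ = _ := by
        rw [← ENNReal.ofReal_mul hβ₀.le, ← ENNReal.ofReal_mul hβ1'.le,
          ← ENNReal.ofReal_add (by positivity) (by positivity),
          ← ENNReal.ofReal_add hC0 (by positivity)]
        congr 1
        field_simp
        ring

/-- The recursion with all utilities replaced by their absolute values has a fixed point. -/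
theorem exists_fixedPoint_expOp_abs (hQ : Kernel.Invariant Q Q₀) (hβ₀ : 0 < β) (hβ₁ : β < 1)
    {r : ℝ} (hr : 1 < r) (ha : Measurable a) (hh : MemHeart (Q₀ ⊗ₘ Q) r a) :
    ∃ F : X → ℝ≥0∞, Measurable F ∧ 1 ≤ F ∧ expOp Q β (fun p => |a p|) F = F ∧
      (∀ᵐ x ∂Q₀, F x < ∞) ∧ MemHeart Q₀ r (fun x => Real.log (F x).toReal) := by
  have hbd : ∀ c : ℝ, ∃ D : ℝ≥0∞, 0 < c → D < ∞ ∧ ∀ f : X → ℝ, Measurable f →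
      modular Q₀ r f c ≤ D →
      modular Q₀ r (fun x => β * logCondExp Q (fun p => f p.2 + |a p|) x) c ≤ D := fun c => by
    by_cases hc : 0 < c
    · obtain ⟨D, hD⟩ := exists_modular_bound hQ hβ₀ hβ₁ hr ha hh hc
      exact ⟨D, fun _ => hD⟩
    · exact ⟨0, fun h => absurd h hc⟩
  choose D hD using hbd
  have hiter := iterate_expOp_bound hQ hβ₀ hr ha hh (D := D) (fun c hc => (hD c hc).1)
    fun c hc => (hD c hc).2
  have habs : Measurable fun p => |a p| := continuous_abs.measurable.comp ha
  have hle : (1 : X → ℝ≥0∞) ≤ expOp Q β (fun p => |a p|) 1 := one_le_expOp_abs hβ₀ le_rfl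
  have hmono := monotone_iterate_expOp hβ₀ hle
  have hmeas := measurable_iterate_expOp (Q := Q) (β := β) habs (measurable_one (α := ℝ≥0∞))
  have hFm : Measurable (⨆ n, (expOp Q β (fun p => |a p|))^[n] 1) :=
    measurable_iSup_iterate_expOp habs measurable_one
  have hF1 : 1 ≤ ⨆ n, (expOp Q β (fun p => |a p|))^[n] 1 :=
    le_iSup (fun n => (expOp Q β (fun p => |a p|))^[n] (1 : X → ℝ≥0∞)) 0
  -- The modular bound at `c = 1` bounds the means of the iterates uniformly, and monotone
  -- convergence passes this to the supremum.
  have hfin : ∀ᵐ x ∂Q₀, (⨆ n, (expOp Q β (fun p => |a p|))^[n] 1) x < ∞ := by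
    refine ae_lt_top hFm (ne_of_lt (lt_of_le_of_lt ?_ (ENNReal.add_lt_top.2
      ⟨ENNReal.ofReal_lt_top (r := Real.exp 1 + 1), (hD 1 one_pos).1⟩)))
    simp only [iSup_apply]
    rw [lintegral_iSup hmeas hmono]
    refine iSup_le fun n => ?_
    refine le_trans (le_of_eq ?_) ((lintegral_exp_le hr.le one_pos).trans
      (add_le_add le_rfl ((hiter n).2 1 one_pos)))
    refine lintegral_congr_ae ?_
    filter_upwards [(hiter n).1] with x hx
    have h1 := one_le_iterate_expOp_abs (Q := Q) (a := a) hβ₀ n x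
    rw [abs_of_nonneg (log_toReal_nonneg h1), div_one,
      ofReal_exp_log_toReal (zero_lt_one.trans_le h1).ne' hx.ne]
  refine ⟨⨆ n, (expOp Q β (fun p => |a p|))^[n] 1, hFm, hF1,
    expOp_iSup_iterate hβ₀ habs measurable_one hle, hfin, ?_⟩
  refine (memHeart_iff hr.le).2
    ⟨(Real.measurable_log.comp hFm.ennreal_toReal).aestronglyMeasurable, fun c hc => ?_⟩
  refine lt_of_le_of_lt (modular_le_of_tendsto hr.le
    (F := fun n x => Real.log ((expOp Q β (fun p => |a p|))^[n] 1 x).toReal)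
    (fun n => (Real.measurable_log.comp (hmeas n).ennreal_toReal).aestronglyMeasurable) ?_
    (Filter.Eventually.of_forall fun n => (hiter n).2 c hc)) (hD c hc).1
  filter_upwards [hfin] with x hx
  have h1 : Filter.Tendsto (fun n => (expOp Q β (fun p => |a p|))^[n] 1 x) Filter.atTop
      (nhds ((⨆ n, (expOp Q β (fun p => |a p|))^[n] 1) x)) := by
    rw [iSup_apply]
    exact tendsto_atTop_iSup fun m n hmn => hmono hmn x
  have h2 := (ENNReal.tendsto_toReal hx.ne).comp h1
  have hne : ((⨆ n, (expOp Q β (fun p => |a p|))^[n] 1) x).toReal ≠ 0 :=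
    (ENNReal.toReal_pos (zero_lt_one.trans_le (hF1 x)).ne' hx.ne).ne'
  exact (Real.continuousAt_log hne).tendsto.comp h2

theorem inv_lintegral_le_lintegral_inv {ν : Measure X} [IsProbabilityMeasure ν] {k : X → ℝ≥0∞}
    (hk : Measurable k) : (∫⁻ y, k y ∂ν)⁻¹ ≤ ∫⁻ y, (k y)⁻¹ ∂ν := by
  set t := ∫⁻ y, k y ∂ν with ht
  rcases eq_or_ne t ∞ with htop | htop
  · simp [htop]
  rcases eq_or_ne t 0 with h0 | h0
  · have := (lintegral_eq_zero_iff hk).1 (ht.symm.trans h0)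
    have h : ∫⁻ y, (k y)⁻¹ ∂ν = ∫⁻ _, ∞ ∂ν := by
      refine lintegral_congr_ae ?_
      filter_upwards [this] with y hy
      simp [hy]
    rw [h]
    simp
  have hti : t⁻¹ ≠ ∞ := ENNReal.inv_ne_top.2 h0
  have hti0 : t⁻¹ ≠ 0 := ENNReal.inv_ne_zero.2 htop
  -- The tangent line of `1/z` at the mean `t`, rearranged to avoid subtraction in `[0,∞]`.
  have hpt : ∀ z : ℝ≥0∞, t⁻¹ + t⁻¹ ≤ t⁻¹ * t⁻¹ * z + z⁻¹ := by
    intro z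
    rcases eq_or_ne z ∞ with rfl | hz
    · rw [ENNReal.mul_top (mul_ne_zero hti0 hti0)]
      simp
    rcases eq_or_ne z 0 with rfl | hz0
    · simp
    have htr := ENNReal.toReal_pos h0 htop
    have hzr := ENNReal.toReal_pos hz0 hz
    rw [← ENNReal.ofReal_toReal htop, ← ENNReal.ofReal_toReal hz, ← ENNReal.ofReal_inv_of_pos htr,
      ← ENNReal.ofReal_inv_of_pos hzr, ← ENNReal.ofReal_mul (by positivity),
      ← ENNReal.ofReal_mul (by positivity), ← ENNReal.ofReal_add (by positivity) (by positivity),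
      ← ENNReal.ofReal_add (by positivity) (by positivity)]
    refine ENNReal.ofReal_le_ofReal ?_
    have e : t.toReal⁻¹ * t.toReal⁻¹ * z.toReal + z.toReal⁻¹ - (t.toReal⁻¹ + t.toReal⁻¹) =
        (t.toReal - z.toReal) ^ 2 * (t.toReal⁻¹ * t.toReal⁻¹ * z.toReal⁻¹) := by
      field_simp
      ring
    have : 0 ≤ (t.toReal - z.toReal) ^ 2 * (t.toReal⁻¹ * t.toReal⁻¹ * z.toReal⁻¹) := by positivity
    linarith
  have h := lintegral_mono (μ := ν) fun y => hpt (k y)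
  rw [lintegral_const, measure_univ, mul_one, lintegral_add_left (hk.const_mul _),
    lintegral_const_mul _ hk, ← ht, mul_assoc, ENNReal.inv_mul_cancel h0 htop, mul_one] at h
  exact (ENNReal.add_le_add_iff_left hti).1 h

/-- Jensen for `1/z` together with `e^{-|a|} ≤ e^a`. This supplies the lower starting point of the
iteration for `a`. -/
theorem inv_le_expOp_inv (hβ : 0 < β) (ha : Measurable a) (hF : Measurable F)
    (hfix : expOp Q β (fun p => |a p|) F = F) :
    F⁻¹ ≤ expOp Q β a F⁻¹ := by
  intro x
  have hm : Measurable fun y => F y * ENNReal.ofReal (Real.exp |a (x, y)|) :=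
    hF.mul (Real.measurable_exp.comp
      (continuous_abs.measurable.comp (ha.comp measurable_prodMk_left))).ennreal_ofReal
  calc F⁻¹ x = ((∫⁻ y, F y * ENNReal.ofReal (Real.exp |a (x, y)|) ∂(Q x))⁻¹) ^ β := by
        rw [ENNReal.inv_rpow, Pi.inv_apply]
        conv_lhs => rw [← hfix]
        rfl
    _ ≤ expOp Q β a F⁻¹ x := by
        refine ENNReal.rpow_le_rpow ((inv_lintegral_le_lintegral_inv hm).trans
          (lintegral_mono fun y => ?_)) hβ.le
        have hpos := Real.exp_pos |a (x, y)|
        change (F y * ENNReal.ofReal (Real.exp |a (x, y)|))⁻¹ ≤ (F y)⁻¹ * _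
        rw [ENNReal.mul_inv (Or.inr ENNReal.ofReal_ne_top)
          (Or.inr (ENNReal.ofReal_pos.2 hpos).ne'), ← ENNReal.ofReal_inv_of_pos hpos,
          ← Real.exp_neg]
        gcongr
        exact neg_abs_le _

theorem abs_log_toReal_le {y z : ℝ≥0∞} (hz : 1 ≤ z) (hz' : z ≠ ∞) (h1 : z⁻¹ ≤ y) (h2 : y ≤ z) :
    |Real.log y.toReal| ≤ Real.log z.toReal := by
  have hzp : 0 < z.toReal := ENNReal.toReal_pos (zero_lt_one.trans_le hz).ne' hz'
  have hyt : y ≠ ∞ := ne_top_of_le_ne_top hz' h2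
  have hyz := ENNReal.toReal_mono hz' h2
  have hzy := ENNReal.toReal_mono hyt h1
  rw [ENNReal.toReal_inv] at hzy
  have hyp : 0 < y.toReal := lt_of_lt_of_le (by positivity) hzy
  rw [abs_le]
  refine ⟨?_, Real.log_le_log hyp hyz⟩
  have := Real.log_le_log (by positivity) hzy
  rwa [Real.log_inv] at this

/-- Existence of a solution of the value recursion. -/
theorem exists_value (hQ : Kernel.Invariant Q Q₀) (hβ₀ : 0 < β) (hβ₁ : β < 1)
    {r : ℝ} (hr : 1 < r) (ha : Measurable a) (hh : MemHeart (Q₀ ⊗ₘ Q) r a) :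
    ∃ v : X → ℝ, Measurable v ∧ MemHeart Q₀ r v ∧
      ∀ᵐ x ∂Q₀, β * Real.log (∫ y, Real.exp (v y + a (x, y)) ∂(Q x)) = v x := by
  obtain ⟨F, hFm, hF1, hfix, hfin, hheart⟩ := exists_fixedPoint_expOp_abs hQ hβ₀ hβ₁ hr ha hh
  have hle := inv_le_expOp_inv hβ₀ ha hFm hfix
  -- Since `a ≤ |a|`, the fixed point `F` for `|a|` is a supersolution for `a`.
  have hiter : ∀ n, (expOp Q β a)^[n] F⁻¹ ≤ F := fun n => by
    induction n with
    | zero => exact fun x => (ENNReal.inv_le_one.2 (hF1 x)).trans (hF1 x)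
    | succ n ih =>
      rw [Function.iterate_succ_apply']
      conv_rhs => rw [← hfix]
      exact expOp_mono hβ₀ (fun p => le_abs_self _) ih
  obtain ⟨G, hG⟩ : ∃ G : X → ℝ≥0∞, G = ⨆ n, (expOp Q β a)^[n] F⁻¹ := ⟨_, rfl⟩
  have hGmeas : Measurable G := hG ▸ measurable_iSup_iterate_expOp ha hFm.inv
  have hGfix : expOp Q β a G = G := hG ▸ expOp_iSup_iterate hβ₀ ha hFm.inv hle
  have hFG : F⁻¹ ≤ G := hG ▸ le_iSup (fun n => (expOp Q β a)^[n] F⁻¹) 0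
  have hGF : G ≤ F := hG ▸ iSup_le hiter
  have hvm : Measurable fun x => Real.log (G x).toReal :=
    Real.measurable_log.comp hGmeas.ennreal_toReal
  have hv : MemHeart Q₀ r fun x => Real.log (G x).toReal := by
    refine hheart.mono hr.le hvm.aestronglyMeasurable ?_
    filter_upwards [hfin] with x hx
    rw [abs_of_nonneg (log_toReal_nonneg (hF1 x))]
    exact abs_log_toReal_le (hF1 x) hx.ne (hFG x) (hGF x)
  have hGne : ∀ᵐ x ∂Q₀, G x ≠ 0 ∧ G x ≠ ∞ := by
    filter_upwards [hfin] with x hx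
    exact ⟨((ENNReal.inv_pos.2 hx.ne).trans_le (hFG x)).ne', ((hGF x).trans_lt hx).ne⟩
  refine ⟨_, hvm, hv, ?_⟩
  filter_upwards [hGne, ae_ae_of_invariant hQ hGne,
    ((hv.comp_snd hQ hr.le).add hr.le hh).ae_integrable_exp hr.le] with x h1 h2 h3
  rw [← lintegral_ofReal_exp h3, ← lintegral_mul_exp_eq h2]
  have h4 := congrFun hGfix x
  rw [expOp] at h4
  conv_rhs => rw [← h4]
  rw [← ENNReal.toReal_rpow, Real.log_rpow]
  refine ENNReal.toReal_pos ?_ ?_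
  · intro h0
    rw [h0, ENNReal.zero_rpow_of_pos hβ₀] at h4
    exact h1.1 h4.symm
  · intro h0
    rw [h0, ENNReal.top_rpow_of_pos hβ₀] at h4
    exact h1.2 h4.symm

end FixedPoint

/-! ### Gibbs densities and their entropy -/

section Gibbs

variable {Y : Type*} [MeasurableSpace Y] {ν : Measure Y} [IsProbabilityMeasure ν]

/-- The subgradient inequality for the convex functional `p ↦ log E[exp p]`. -/
theorem integral_gibbs_mul_sub_le {p q : Y → ℝ} (hp : Integrable (fun y => Real.exp (p y)) ν)
    (hq : Integrable (fun y => Real.exp (q y)) ν)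
    (hd : Integrable (fun y => Real.exp (p y) / (∫ z, Real.exp (p z) ∂ν) * (q y - p y)) ν) :
    ∫ y, Real.exp (p y) / (∫ z, Real.exp (p z) ∂ν) * (q y - p y) ∂ν ≤
      Real.log (∫ y, Real.exp (q y) ∂ν) - Real.log (∫ y, Real.exp (p y) ∂ν) := by
  have hZp : 0 < ∫ y, Real.exp (p y) ∂ν := integral_exp_pos hp
  have hZq : 0 < ∫ y, Real.exp (q y) ∂ν := integral_exp_pos hq
  set Zp := ∫ y, Real.exp (p y) ∂ν with hZp'
  set Zq := ∫ y, Real.exp (q y) ∂ν with hZq'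
  set m := ∫ y, Real.exp (p y) / Zp * (q y - p y) ∂ν with hm
  have hk : Integrable (fun y => Real.exp (p y) / Zp) ν := hp.div_const _
  have hk1 : ∫ y, Real.exp (p y) / Zp ∂ν = 1 := by rw [integral_div, ← hZp', div_self hZp.ne']
  -- The tangent line of `exp` at `m`, evaluated at `q - p` and integrated against the Gibbs density
  -- of `p`; `m` is the mean of `q - p` under it, so the left side integrates to `e^m`.
  have h : ∫ y, Real.exp m * ((1 - m) * (Real.exp (p y) / Zp) +
      Real.exp (p y) / Zp * (q y - p y)) ∂ν ≤ ∫ y, Real.exp (q y) / Zp ∂ν := by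
    refine integral_mono (((hk.const_mul _).add hd).const_mul _) (hq.div_const _) fun y => ?_
    change Real.exp m * ((1 - m) * (Real.exp (p y) / Zp) + Real.exp (p y) / Zp * (q y - p y)) ≤
      Real.exp (q y) / Zp
    have h1 := Real.add_one_le_exp (q y - p y - m)
    have h2 : Real.exp (q y) = Real.exp m * Real.exp (p y) * Real.exp (q y - p y - m) := by
      rw [← Real.exp_add, ← Real.exp_add]
      congr 1
      ring
    rw [h2]
    calc _ = Real.exp m * Real.exp (p y) * (q y - p y - m + 1) / Zp := by ring
      _ ≤ _ := by gcongr
  rw [integral_const_mul, integral_add (hk.const_mul _) hd, integral_const_mul, hk1, ← hm,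
    integral_div, ← hZq'] at h
  have h3 : Real.exp m ≤ Zq / Zp := by linarith
  rw [← Real.log_div hZq.ne' hZp.ne']
  exact (Real.le_log_iff_exp_le (by positivity)).2 h3

variable {X : Type*} [MeasurableSpace X] {Q₀ : Measure X} [IsProbabilityMeasure Q₀]
  {Q : Kernel X X} {s : ℝ} {w : X × X → ℝ}

/-- The transition density proportional to `exp w`. -/
def gibbs (Q : Kernel X X) (w : X × X → ℝ) (x y : X) : ℝ :=
  Real.exp (w (x, y)) / ∫ z, Real.exp (w (x, z)) ∂(Q x)

theorem gibbs_nonneg (x y : X) : 0 ≤ gibbs Q w x y :=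
  div_nonneg (Real.exp_pos _).le (integral_nonneg fun _ => (Real.exp_pos _).le)

variable [IsMarkovKernel Q]

theorem measurable_gibbs (hw : Measurable w) : Measurable (Function.uncurry (gibbs Q w)) := by
  have h : StronglyMeasurable fun x => ∫ z, Real.exp (w (x, z)) ∂(Q x) :=
    StronglyMeasurable.integral_kernel_prod_right' (f := fun p : X × X => Real.exp (w p))
      (Real.measurable_exp.comp hw).stronglyMeasurable
  exact (Real.measurable_exp.comp hw).div (h.measurable.comp measurable_fst)

/-- The heart contains `2w` along with `w`, so `e^{2w}` has finite conditional expectation. -/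
theorem integrable_gibbs_sq (hs : 1 ≤ s) (hwh : MemHeart (Q₀ ⊗ₘ Q) s w) :
    ∀ᵐ x ∂Q₀, Integrable (fun y => gibbs Q w x y ^ 2) (Q x) := by
  filter_upwards [(hwh.smul hs 2).ae_integrable_exp hs] with x hx
  refine (hx.div_const ((∫ z, Real.exp (w (x, z)) ∂(Q x)) ^ 2)).congr
    (Filter.Eventually.of_forall fun y => ?_)
  simp only [gibbs, div_pow]
  rw [← Real.exp_nat_mul]
  norm_num

theorem entropicDensity_gibbs (hs : 1 ≤ s) (hw : Measurable w) (hwh : MemHeart (Q₀ ⊗ₘ Q) s w) :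
    EntropicDensity Q₀ Q (gibbs Q w) where
  measurable := measurable_gibbs hw
  nonneg := gibbs_nonneg
  integrable := by
    filter_upwards [hwh.ae_integrable_exp hs] with x hx
    exact hx.div_const _
  integral_eq_one := by
    filter_upwards [hwh.ae_integrable_exp hs] with x hx
    simp only [gibbs]
    rw [integral_div, div_self (integral_exp_pos hx).ne']
  integrable_entropy := by
    filter_upwards [integrable_gibbs_sq hs hwh] with x hx
    have hm : Measurable (gibbs Q w x) := (measurable_gibbs hw).comp measurable_prodMk_left
    -- The majorant comes from `k - 1 ≤ k log k ≤ k²`.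
    refine ((integrable_const (1 : ℝ)).add hx).mono'
      (hm.mul (Real.measurable_log.comp hm)).aestronglyMeasurable
      (Filter.Eventually.of_forall fun y => ?_)
    have h0 : 0 ≤ gibbs Q w x y := gibbs_nonneg x y
    have h1 := mul_le_mul_log_add_exp (a := 0) h0
    have h2 := mul_le_mul_of_nonneg_left (Real.log_le_self h0) h0
    rw [mul_zero, Real.exp_zero] at h1
    rw [Real.norm_eq_abs, abs_le]
    simp only [Pi.add_apply]
    constructor <;> nlinarith

/-- Jensen for `log` under the density `k` itself gives `E[k log k] ≤ log E[k²]`, and `E[k²] =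
E[e^{2w}] / E[e^w]²`. -/
theorem relEntropy_gibbs_le (hs : 1 ≤ s) (hw : Measurable w) (hwh : MemHeart (Q₀ ⊗ₘ Q) s w) :
    ∀ᵐ x ∂Q₀, relEntropy Q (gibbs Q w) x ≤ logCondExp Q (fun p => 2 * w p) x +
      2 * |Real.log (∫ z, Real.exp (w (x, z)) ∂(Q x))| := by
  have hk := entropicDensity_gibbs hs hw hwh
  filter_upwards [hwh.ae_integrable_exp hs, (hwh.smul hs 2).ae_integrable_exp hs,
    ((hwh.smul hs 2).abs hs).ae_integrable_exp hs, integrable_gibbs_sq hs hwh, hk.integrable,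
    hk.integral_eq_one, hk.integrable_entropy] with x h1 h2 h3 h4 h5 h6 h7
  have hZ : 0 < ∫ z, Real.exp (w (x, z)) ∂(Q x) := integral_exp_pos h1
  have hE : 0 < ∫ z, Real.exp (2 * w (x, z)) ∂(Q x) := integral_exp_pos h2
  have ht : ∫ y, gibbs Q w x y ^ 2 ∂(Q x) =
      (∫ z, Real.exp (2 * w (x, z)) ∂(Q x)) / (∫ z, Real.exp (w (x, z)) ∂(Q x)) ^ 2 := by
    rw [← integral_div]
    refine integral_congr_ae (Filter.Eventually.of_forall fun y => ?_)
    simp only [gibbs, div_pow]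
    rw [← Real.exp_nat_mul]
    norm_num
  set Z := ∫ z, Real.exp (w (x, z)) ∂(Q x) with hZ'
  set t := ∫ y, gibbs Q w x y ^ 2 ∂(Q x) with ht'
  have htpos : 0 < t := by rw [ht]; positivity
  have hle : relEntropy Q (gibbs Q w) x ≤ Real.log t := by
    -- The tangent line of `log` at the second moment `t`, weighted by the density.
    have h : relEntropy Q (gibbs Q w) x ≤
        ∫ y, ((Real.log t - 1) * gibbs Q w x y + gibbs Q w x y ^ 2 / t) ∂(Q x) := by
      refine integral_mono h7 ((h5.const_mul _).add (h4.div_const _)) fun y => ?_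
      change gibbs Q w x y * Real.log (gibbs Q w x y) ≤
        (Real.log t - 1) * gibbs Q w x y + gibbs Q w x y ^ 2 / t
      have hkp : 0 < gibbs Q w x y := div_pos (Real.exp_pos _) hZ
      have hl := Real.log_le_sub_one_of_pos (div_pos hkp htpos)
      rw [Real.log_div hkp.ne' htpos.ne'] at hl
      calc _ ≤ gibbs Q w x y * (Real.log t + (gibbs Q w x y / t - 1)) := by
            gcongr
            linarith
        _ = _ := by ring
    rw [integral_add (h5.const_mul _) (h4.div_const _), integral_const_mul, h6, integral_div,
      ← ht', div_self htpos.ne'] at h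
    linarith
  refine hle.trans ?_
  rw [ht, Real.log_div hE.ne' (by positivity), Real.log_pow]
  have h8 : Real.log (∫ z, Real.exp (2 * w (x, z)) ∂(Q x)) ≤ logCondExp Q (fun p => 2 * w p) x := by
    rw [logCondExp, lintegral_ofReal_exp h3]
    exact Real.log_le_log hE (integral_mono h2 h3 fun y => Real.exp_le_exp.2 (le_abs_self _))
  have h9 := neg_abs_le (Real.log Z)
  push_cast
  linarith

/-- The hypothesis on the normalizing constant is supplied by the fixed-point equation, which
identifies its logarithm with `v/β`. -/
theorem memHeart_relEntropy_gibbs (hs : 1 < s) (hw : Measurable w)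
    (hwh : MemHeart (Q₀ ⊗ₘ Q) s w)
    (hZ : MemHeart Q₀ s fun x => Real.log (∫ z, Real.exp (w (x, z)) ∂(Q x))) :
    MemHeart Q₀ s (relEntropy Q (gibbs Q w)) := by
  have hk := entropicDensity_gibbs hs.le hw hwh
  have hm : AEStronglyMeasurable (relEntropy Q (gibbs Q w)) Q₀ :=
    (StronglyMeasurable.integral_kernel_prod_right'
      (f := fun p : X × X => gibbs Q w p.1 p.2 * Real.log (gibbs Q w p.1 p.2))
      ((measurable_gibbs hw).mul
        (Real.measurable_log.comp (measurable_gibbs hw))).stronglyMeasurable).aestronglyMeasurable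
  refine (((hwh.smul hs.le 2).logCondExp hs (hw.const_mul 2)).add hs.le
    ((hZ.abs hs.le).smul hs.le 2)).mono hs.le hm ?_
  filter_upwards [relEntropy_gibbs_le hs.le hw hwh, hk.integrable, hk.integral_eq_one,
    hk.integrable_entropy] with x h1 h2 h3 h4
  have h0 : 0 ≤ relEntropy Q (gibbs Q w) x := entropy_nonneg (hk.nonneg x) h2 h3 h4
  rw [abs_of_nonneg h0]
  exact h1.trans (le_abs_self _)

end Gibbs

/-! ### Uniqueness of the value function -/

section Uniqueness

variable {X : Type*} [MeasurableSpace X] {Q₀ : Measure X} {Q : Kernel X X} {s β : ℝ} {a : X × X → ℝ} {v w : X → ℝ}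

theorem memHeart_log_of_fixedPoint (hβ₀ : 0 < β) (hs : 1 ≤ s) (hv : MemHeart Q₀ s v)
    (hfix : ∀ᵐ x ∂Q₀, β * Real.log (∫ y, Real.exp (v y + a (x, y)) ∂(Q x)) = v x) :
    MemHeart Q₀ s fun x => Real.log (∫ y, Real.exp (v y + a (x, y)) ∂(Q x)) := by
  refine (hv.smul hs β⁻¹).congr ?_
  filter_upwards [hfix] with x hx
  rw [← hx, ← mul_assoc, inv_mul_cancel₀ hβ₀.ne', one_mul]

theorem integral_exp_congr (hQ : Kernel.Invariant Q Q₀) (h : v =ᵐ[Q₀] w) :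
    ∀ᵐ x ∂Q₀, ∫ y, Real.exp (v y + a (x, y)) ∂(Q x) = ∫ y, Real.exp (w y + a (x, y)) ∂(Q x) := by
  filter_upwards [ae_ae_of_invariant hQ h] with x hx
  refine integral_congr_ae ?_
  filter_upwards [hx] with y hy
  rw [hy]

variable [IsProbabilityMeasure Q₀] [IsMarkovKernel Q]

/-- Two solutions of the value recursion are ordered, by its convexity. -/
theorem ae_le_of_fixedPoint (hQ : Kernel.Invariant Q Q₀) (hβ₀ : 0 < β) (hβ₁ : β < 1) (hs : 1 < s)
    (ha : Measurable a) (hah : MemHeart (Q₀ ⊗ₘ Q) s a) (hvm : Measurable v)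
    (hv : MemHeart Q₀ s v) (hw : MemHeart Q₀ s w)
    (hvfix : ∀ᵐ x ∂Q₀, β * Real.log (∫ y, Real.exp (v y + a (x, y)) ∂(Q x)) = v x)
    (hwfix : ∀ᵐ x ∂Q₀, β * Real.log (∫ y, Real.exp (w y + a (x, y)) ∂(Q x)) = w x) :
    ∀ᵐ x ∂Q₀, v x ≤ w x := by
  have hvm' : Measurable fun p : X × X => v p.2 + a p := (hvm.comp measurable_snd).add ha
  have hvh := (hv.comp_snd hQ hs.le).add hs.le hah
  have hwh := (hw.comp_snd hQ hs.le).add hs.le hah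
  have hk := entropicDensity_gibbs hs.le hvm' hvh
  have hent := memHeart_relEntropy_gibbs hs hvm' hvh
    (memHeart_log_of_fixedPoint hβ₀ hs.le hv hvfix)
  have hd : MemHeart Q₀ s fun x => w x - v x := hw.sub hs.le hv
  have hf : MemHeart Q₀ s fun x => max (v x - w x) 0 := by
    refine hd.mono hs.le ((hv.sub hs.le hw).1.1.aemeasurable.max
      aemeasurable_const).aestronglyMeasurable
      (Filter.Eventually.of_forall fun x => ?_)
    rw [abs_of_nonneg (le_max_right _ _), abs_sub_comm]
    exact max_le (le_abs_self _) (abs_nonneg _)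
  -- With `P` the tilt at `v`, the subgradient inequality gives `v - w ≤ βP(v - w) ≤ βP(v - w)⁺`,
  -- and the last term is nonnegative.
  have hzero := hk.ae_eq_zero_of_le_tilt hQ hs.le hent hβ₀ hβ₁ hf
    (Filter.Eventually.of_forall fun x => le_max_right _ _) (by
      filter_upwards [hk.integrable_mul hQ hs.le hd, hk.integrable_mul hQ hs.le hf,
        hvh.ae_integrable_exp hs.le, hwh.ae_integrable_exp hs.le, hvfix, hwfix]
        with x h1 h2 h3 h4 h5 h6
      have e : ∀ y, w y + a (x, y) - (v y + a (x, y)) = w y - v y := fun y => by ring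
      have hsub := integral_gibbs_mul_sub_le h3 h4 (by simp only [e]; exact h1)
      simp only [e] at hsub
      have hmono : -∫ y, gibbs Q (fun p => v p.2 + a p) x y * (w y - v y) ∂(Q x) ≤
          tilt Q (gibbs Q fun p => v p.2 + a p) (fun x => max (v x - w x) 0) x := by
        rw [← integral_neg]
        refine integral_mono h1.neg h2 fun y => ?_
        have h0 : 0 ≤ gibbs Q (fun p => v p.2 + a p) x y := gibbs_nonneg x y
        change -(gibbs Q (fun p => v p.2 + a p) x y * (w y - v y)) ≤ _
        rw [← mul_neg, neg_sub]
        exact mul_le_mul_of_nonneg_left (le_max_left _ _) h0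
      refine max_le ?_ (mul_nonneg hβ₀.le (integral_nonneg fun y =>
        mul_nonneg (gibbs_nonneg x y) (le_max_right _ _)))
      have h7 := mul_le_mul_of_nonneg_left hsub hβ₀.le
      have h8 := mul_le_mul_of_nonneg_left hmono hβ₀.le
      change β * ∫ y, gibbs Q (fun p => v p.2 + a p) x y * (w y - v y) ∂(Q x) ≤ _ at h7
      rw [mul_sub, h5, h6] at h7
      linarith)
  filter_upwards [hzero] with x hx
  have := le_max_left (v x - w x) 0
  rw [hx] at this
  linarith

/-- The value recursion has at most one solution in the Orlicz heart. -/
theorem ae_eq_of_fixedPoint (hQ : Kernel.Invariant Q Q₀) (hβ₀ : 0 < β) (hβ₁ : β < 1) (hs : 1 < s)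
    (ha : Measurable a) (hah : MemHeart (Q₀ ⊗ₘ Q) s a)
    (hv : MemHeart Q₀ s v) (hw : MemHeart Q₀ s w)
    (hvfix : ∀ᵐ x ∂Q₀, β * Real.log (∫ y, Real.exp (v y + a (x, y)) ∂(Q x)) = v x)
    (hwfix : ∀ᵐ x ∂Q₀, β * Real.log (∫ y, Real.exp (w y + a (x, y)) ∂(Q x)) = w x) :
    v =ᵐ[Q₀] w := by
  have key : ∀ f g : X → ℝ, MemHeart Q₀ s f → MemHeart Q₀ s g →
      (∀ᵐ x ∂Q₀, β * Real.log (∫ y, Real.exp (f y + a (x, y)) ∂(Q x)) = f x) →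
      (∀ᵐ x ∂Q₀, β * Real.log (∫ y, Real.exp (g y + a (x, y)) ∂(Q x)) = g x) →
      ∀ᵐ x ∂Q₀, f x ≤ g x := fun f g hf hg hf' hg' => by
    have hmk := hf.1.1.ae_eq_mk
    have h := ae_le_of_fixedPoint hQ hβ₀ hβ₁ hs ha hah hf.1.1.stronglyMeasurable_mk.measurable
      (hf.congr hmk) hg (by
        filter_upwards [hf', hmk, integral_exp_congr (a := a) hQ hmk] with x h1 h2 h3
        rw [← h3, h1, h2]) hg'
    filter_upwards [h, hmk] with x h1 h2
    rwa [h2]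
  filter_upwards [key v w hv hw hvfix hwfix, key w v hw hv hwfix hvfix] with x h1 h2
  exact le_antisymm h1 h2

end Uniqueness

/-! ### The entropy equation in the Orlicz heart -/

section Entropy

variable {X : Type*} [MeasurableSpace X] {Q₀ : Measure X} {Q : Kernel X X} {s β : ℝ} {k : X → X → ℝ}

theorem apply_eq_iff_eq_inverse {E : Type*} [NormedAddCommGroup E] [NormedSpace ℝ E]
    {T : E →L[ℝ] E} (hT : IsUnit T) (x y : E) : T x = y ↔ x = Ring.inverse T y := by
  constructor
  · rintro rfl
    change x = (Ring.inverse T * T) x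
    rw [Ring.inverse_mul_cancel T hT]
    rfl
  · rintro rfl
    change (T * Ring.inverse T) y = y
    rw [Ring.mul_inverse_cancel T hT]
    rfl

/-- The a.e. form of the equation does not mention `s`, which allows solutions in different hearts
to be compared. -/
theorem one_sub_apply_eq_iff [hs : Fact (1 ≤ s)]
    {D : OrliczHeart Q₀ s →L[ℝ] OrliczHeart Q₀ s} {χ : OrliczHeart Q₀ s}
    (hD : ∀ f : OrliczHeart Q₀ s, (D f : X →ₘ[Q₀] ℝ) =ᵐ[Q₀]
      fun x => β * tilt Q k (f : X →ₘ[Q₀] ℝ) x)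
    (hχ : (χ : X →ₘ[Q₀] ℝ) =ᵐ[Q₀] fun x => β * relEntropy Q k x) (G : OrliczHeart Q₀ s) :
    (1 - D) G = χ ↔ ∀ᵐ x ∂Q₀, (G : X →ₘ[Q₀] ℝ) x - β * tilt Q k (G : X →ₘ[Q₀] ℝ) x =
      β * relEntropy Q k x := by
  have e : (1 - D) G = G - D G := rfl
  rw [e, ← Subtype.coe_inj, AEEqFun.ext_iff]
  constructor
  · intro h
    filter_upwards [h, OrliczHeart.coeFn_sub G (D G), hD G, hχ] with x h1 h2 h3 h4
    rw [← h4, ← h1, h2, h3]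
  · intro h
    filter_upwards [h, OrliczHeart.coeFn_sub G (D G), hD G, hχ] with x h1 h2 h3 h4
    rw [h4, ← h1, h2, h3]

variable [IsProbabilityMeasure Q₀] [IsMarkovKernel Q]

/-- The discounted operator and the discounted entropy in the Orlicz heart. -/
theorem EntropicDensity.exists_discountedCLM [hs : Fact (1 ≤ s)] (hk : EntropicDensity Q₀ Q k)
    (hQ : Kernel.Invariant Q Q₀) (hent : MemHeart Q₀ s (relEntropy Q k)) (hβ₀ : 0 < β)
    (hβ₁ : β < 1) :
    ∃ (D : OrliczHeart Q₀ s →L[ℝ] OrliczHeart Q₀ s) (χ : OrliczHeart Q₀ s),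
      (∀ f : OrliczHeart Q₀ s, (D f : X →ₘ[Q₀] ℝ) =ᵐ[Q₀]
        fun x => β * tilt Q k (f : X →ₘ[Q₀] ℝ) x) ∧
      (χ : X →ₘ[Q₀] ℝ) =ᵐ[Q₀] (fun x => β * relEntropy Q k x) ∧ IsUnit (1 - D) := by
  obtain ⟨P, hP⟩ := hk.exists_tiltCLM hQ hent
  have hχ := hent.smul hs.out β
  exact ⟨β • P, ⟨AEEqFun.mk _ hχ.1.1, hχ.congr (AEEqFun.coeFn_mk _ _).symm⟩,
    coeFn_smul_tilt hP β, AEEqFun.coeFn_mk _ _, hk.isUnit_one_sub_smul hQ hent hP hβ₀ hβ₁⟩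

end Entropy

end ThinTail

end

/-! ### Assembly of the main theorem -/

open ThinTail in
theorem theorem3p2 {X : Type*} [MeasurableSpace X]
    (Q₀ : Measure X) [IsProbabilityMeasure Q₀] (Q : Kernel X X) [IsMarkovKernel Q]
    (hQ : Kernel.Invariant Q Q₀)
    (β θ : ℝ) (hβ₀ : 0 < β) (hβ₁ : β < 1) (hθ : 0 < θ)
    (u : X × X → ℝ) (r : ℝ) (hr : 1 < r) (hu : ThinTail.MemHeart (Q₀ ⊗ₘ Q) r u) :
    ∃ v : X → ℝ,
      -- `v` is a fixed point of `T` in `E^{φ_r}`, the only one in each `E^{φ_s}`, `1 < s ≤ r`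
      ThinTail.MemHeart Q₀ r v ∧
      (∀ᵐ x ∂Q₀, Integrable (ThinTail.expWeight β θ u v x) (Q x)) ∧
      ThinTail.valueOp Q β θ u v =ᵐ[Q₀] v ∧
      (∀ s : ℝ, 1 < s → s ≤ r → ∀ w : X → ℝ, ThinTail.MemHeart Q₀ s w →
        ThinTail.valueOp Q β θ u w =ᵐ[Q₀] w → w =ᵐ[Q₀] v) ∧
      -- one function `Γ` is the solution in all the spaces `E^{φ_s}`, `1 ≤ s ≤ r`
      ∃ Γ : X → ℝ, ∀ (s : ℝ) [Fact (1 ≤ s)], s ≤ r →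
        ∃ (D : ThinTail.OrliczHeart Q₀ s →L[ℝ] ThinTail.OrliczHeart Q₀ s)
          (χ Γₛ : ThinTail.OrliczHeart Q₀ s),
          -- `D` is the operator `D_v` on `E^{φ_s}`
          (∀ f : ThinTail.OrliczHeart Q₀ s, ∀ᵐ x ∂Q₀,
            Integrable (fun y => ThinTail.distortion Q β θ u v x y * (f : X →ₘ[Q₀] ℝ) y) (Q x) ∧
            (D f : X →ₘ[Q₀] ℝ) x =
              ThinTail.discountedOp Q β θ u v (f : X →ₘ[Q₀] ℝ) x) ∧
          -- `χ` is the class of `χ_v`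
          (∀ᵐ x ∂Q₀,
            Integrable (fun y => ThinTail.distortion Q β θ u v x y *
              Real.log (ThinTail.distortion Q β θ u v x y)) (Q x) ∧
            (χ : X →ₘ[Q₀] ℝ) x = ThinTail.condEntropy Q β θ u v x) ∧
          -- `Γₛ` is the class of `Γ`
          (Γₛ : X →ₘ[Q₀] ℝ) =ᵐ[Q₀] Γ ∧
          IsUnit (1 - D) ∧
          Γₛ = Ring.inverse (1 - D) χ ∧
          ∀ G : ThinTail.OrliczHeart Q₀ s, (1 - D) G = χ ↔ G = Γₛ := by
  have hαu := hu.smul hr.le (alpha β θ)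
  -- A Borel version of `αu` is used throughout; for almost every `x` it changes the weights only on
  -- a `Q x`-null set.
  set a : X × X → ℝ := hαu.1.1.mk _ with ha_def
  have ha : Measurable a := hαu.1.1.stronglyMeasurable_mk.measurable
  have hae := hαu.1.1.ae_eq_mk
  have hah : MemHeart (Q₀ ⊗ₘ Q) r a := hαu.congr hae
  have hweight : ∀ f : X → ℝ, ∀ᵐ x ∂Q₀,
      expWeight β θ u f x =ᵐ[Q x] fun y => Real.exp (f y + a (x, y)) := fun f => by
    filter_upwards [Measure.ae_ae_of_ae_compProd hae] with x hx
    filter_upwards [hx] with y hy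
    rw [expWeight, hy]
  have hvalue : ∀ f : X → ℝ, ∀ᵐ x ∂Q₀, valueOp Q β θ u f x =
      β * Real.log (∫ y, Real.exp (f y + a (x, y)) ∂(Q x)) := fun f => by
    filter_upwards [hweight f] with x hx
    rw [valueOp, integral_congr_ae hx]
  obtain ⟨v, hvm, hv, hvfix⟩ := exists_value hQ hβ₀ hβ₁ hr ha hah
  have hwm : Measurable fun p : X × X => v p.2 + a p := (hvm.comp measurable_snd).add ha
  have hwh := (hv.comp_snd hQ hr.le).add hr.le hah
  set k := gibbs Q fun p => v p.2 + a p with hk_def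
  have hk : EntropicDensity Q₀ Q k := entropicDensity_gibbs hr.le hwm hwh
  have hent : MemHeart Q₀ r (relEntropy Q k) := memHeart_relEntropy_gibbs hr hwm hwh
    (memHeart_log_of_fixedPoint hβ₀ hr.le hv hvfix)
  have hdist : ∀ᵐ x ∂Q₀, distortion Q β θ u v x =ᵐ[Q x] k x := by
    filter_upwards [hweight v] with x hx
    filter_upwards [hx] with y hy
    rw [distortion, hy, integral_congr_ae hx, hk_def, gibbs]
  refine ⟨v, hv, ?_, ?_, fun s hs hsr w hw hwfix => ?_, ?_⟩
  · filter_upwards [hweight v, hwh.ae_integrable_exp hr.le] with x h1 h2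
    exact h2.congr h1.symm
  · filter_upwards [hvalue v, hvfix] with x h1 h2
    rw [h1, h2]
  · refine ae_eq_of_fixedPoint hQ hβ₀ hβ₁ hs ha (hah.of_le hs.le hsr) hw (hv.of_le hs.le hsr) ?_
      hvfix
    filter_upwards [hvalue w, hwfix] with x h1 h2
    rw [← h1, h2]
  have : Fact ((1 : ℝ) ≤ 1) := ⟨le_rfl⟩
  -- `Γ` is defined in the largest space, `s = 1`, which contains all the other hearts. The entropy
  -- was placed in the heart for `r > 1` and reaches `s = 1` by inclusion.
  obtain ⟨D₁, χ₁, hD₁, hχ₁, hunit₁⟩ := hk.exists_discountedCLM (s := 1) hQ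
    (hent.of_le le_rfl hr.le) hβ₀ hβ₁
  refine ⟨((Ring.inverse (1 - D₁) χ₁ : OrliczHeart Q₀ 1) : X →ₘ[Q₀] ℝ), fun s hs hsr => ?_⟩
  obtain ⟨D, χ, hD, hχ, hunit⟩ := hk.exists_discountedCLM (s := s) hQ
    (hent.of_le hs.out hsr) hβ₀ hβ₁
  refine ⟨D, χ, Ring.inverse (1 - D) χ, fun f => ?_, ?_, ?_, hunit, rfl,
    fun G => apply_eq_iff_eq_inverse hunit G χ⟩
  · filter_upwards [hk.integrable_mul hQ hs.out f.2, hD f, hdist] with x h1 h2 h3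
    have h4 : (fun y => distortion Q β θ u v x y * (f : X →ₘ[Q₀] ℝ) y) =ᵐ[Q x]
        fun y => k x y * (f : X →ₘ[Q₀] ℝ) y := by
      filter_upwards [h3] with y hy
      rw [hy]
    exact ⟨h1.congr h4.symm, by rw [h2, discountedOp, integral_congr_ae h4, tilt]⟩
  · filter_upwards [hk.integrable_entropy, hχ, hdist] with x h1 h2 h3
    have h4 : (fun y => distortion Q β θ u v x y * Real.log (distortion Q β θ u v x y)) =ᵐ[Q x]
        fun y => k x y * Real.log (k x y) := by
      filter_upwards [h3] with y hy
      rw [hy]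
    exact ⟨h1.congr h4.symm, by rw [h2, condEntropy, integral_congr_ae h4, relEntropy]⟩
  · set Γₛ := Ring.inverse (1 - D) χ with hΓ
    -- The solution for `s` lies in the heart for `1` and solves the same a.e. equation there, so
    -- uniqueness for `s = 1` identifies it with `Γ`.
    have h1 := (one_sub_apply_eq_iff hD hχ Γₛ).1 ((apply_eq_iff_eq_inverse hunit Γₛ χ).2 hΓ)
    have h2 := (one_sub_apply_eq_iff hD₁ hχ₁
      ⟨(Γₛ : X →ₘ[Q₀] ℝ), Γₛ.2.of_le le_rfl hs.out⟩).2 h1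
    have h3 := (apply_eq_iff_eq_inverse hunit₁ _ _).1 h2
    rw [← h3]
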